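/- All graphs are finite, simple and have at least one vertex; $\overline{G}$ is the complement of $G$, and $\cup$ denotes disjoint union. The complementary prism $G\overline{G}$ is the graph formed from the disjoint union of $G$ and $\overline{G}$ by adding, for every vertex $v$ of $G$, an edge joining $v$ to the corresponding vertex $\overline{v}$ of $\overline{G}$. A graph $H$ has a $3$-role assignment if there are an undirected graph $R$ with exactly three vertices (without multiple edges, but possibly with loops) and a surjective map $p:V(H)\to V(R)$ such that $p(N_H(v))=N_R(p(v))$ for all $v\in V(H)$, where $N$ denotes the set of neighbors (a vertex with a loop is its own neighbor). Theorem. Let $G$ be a graph. Then $G\overline{G}$ has a $3$-role assignment if and only if neither $G$ nor $\overline{G}$ belongs, up to isomorphism, to one of the following families: (1) the complete graphs $K_n$ with $n\ge 2$; (2) the graphs that have at least one isolated vertex and in which every connected component with at least two vertices is isomorphic to a complete bipartite graph $K_{n,m}$ for some $n,m\ge 1$, with the exception of the graphs $K_1\cup K_{1,m}$, $m\ge 1$; (3) $K_2^t$, the disjoint union of $t$ copies of $K_2$, with $t\ge 4$; (4) the disjoint unions $\bigcup_{i=1}^t K_{1,m_i}$ with $t\ge 3$, all $m_i\ge 1$,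 and $m_i\ge 2$ for at least one $i$; (5) $K_{1,m_1}\cup K_{1,m_2}$ with $m_1,m_2\ge 2$. Moreover, if $G$ has at least two vertices and $G\overline{G}$ has no $3$-role assignment, then at least one of $G$ and $\overline{G}$ is both disconnected and bipartite. -/

import Mathlib

namespace ComplementaryPrism

universe u v

/-- An undirected graph without multiple edges in which loops are allowed. -/
structure LoopGraph (W : Type u) where
  Adj : W → W → Prop
  symm : ∀ a b, Adj a b → Adj b a

/-- The neighborhood of a vertex; it contains the vertex itself exactly when there is a loop. -/
def LoopGraph.neighborSet {W : Type u} (R : LoopGraph W) (a : W) : Set W := {b | R.Adj a b}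

/-- `p` is an `R`-role assignment of the simple graph `G`: it is surjective and
`p (N_G v) = N_R (p v)` for every vertex `v`. -/
def IsRoleAssignment {V : Type u} {W : Type v} (G : SimpleGraph V) (R : LoopGraph W)
    (p : V → W) : Prop :=
  Function.Surjective p ∧ ∀ x : V, p '' G.neighborSet x = R.neighborSet (p x)

/-- `G` has an `r`-role assignment: an `R`-role assignment for some graph `R`, possibly with loops,
on `r` vertices. -/
def HasRoleAssignment {V : Type u} (G : SimpleGraph V) (r : ℕ) : Prop :=
  ∃ (R : LoopGraph (Fin r)) (p : V → Fin r), IsRoleAssignment G R p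

/-- The complementary prism of `G`: the disjoint union of `G` (left copy) and its complement
(right copy), together with the perfect matching joining corresponding vertices. -/
def prism {V : Type u} (G : SimpleGraph V) : SimpleGraph (V ⊕ V) where
  Adj
    | Sum.inl x, Sum.inl y => G.Adj x y
    | Sum.inr x, Sum.inr y => Gᶜ.Adj x y
    | Sum.inl x, Sum.inr y => x = y
    | Sum.inr x, Sum.inl y => x = y
  symm := ⟨by
    rintro (x | x) (y | y) h
    · exact SimpleGraph.Adj.symm h
    · exact Eq.symm h
    · exact Eq.symm h
    · exact SimpleGraph.Adj.symm (G := Gᶜ) h⟩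
  loopless := ⟨by
    rintro (x | x) h
    · exact G.irrefl h
    · exact Gᶜ.irrefl h⟩

/-- The disjoint union of a family of graphs. -/
def disjointUnion {ι : Type u} {α : ι → Type v} (H : (i : ι) → SimpleGraph (α i)) :
    SimpleGraph (Σ i, α i) where
  Adj x y := ∃ (i : ι) (a b : α i), (H i).Adj a b ∧ x = ⟨i, a⟩ ∧ y = ⟨i, b⟩
  symm := ⟨by
    rintro x y ⟨i, a, b, h, hx, hy⟩
    exact ⟨i, b, a, h.symm, hy, hx⟩⟩
  loopless := ⟨by
    rintro x ⟨i, a, b, h, rfl, hy⟩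
    obtain rfl : a = b := by simpa using hy
    exact (H i).irrefl h⟩

/-- The complete graph `K_n`. -/
abbrev K (n : ℕ) : SimpleGraph (Fin n) := SimpleGraph.completeGraph (Fin n)

/-- The complete bipartite graph `K_{n,m}`. -/
abbrev KB (n m : ℕ) : SimpleGraph (Fin n ⊕ Fin m) := completeBipartiteGraph (Fin n) (Fin m)

/-- `G ≃ K_n` for some `n ≥ 2`. -/
def IsCompleteFamily {V : Type u} (G : SimpleGraph V) : Prop :=
  ∃ n : ℕ, 2 ≤ n ∧ Nonempty (G ≃g K n)

/-- `G` has an isolated vertex, every component with at least two vertices is a complete bipartite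
graph `K_{n,m}` with `n, m ≥ 1`, and `G` is not `K_1 ∪ K_{1,m}` with `m ≥ 1`. -/
def IsIsolatedFamily {V : Type u} (G : SimpleGraph V) : Prop :=
  (∃ x : V, G.IsIsolated x) ∧
  (∀ C : G.ConnectedComponent, C.supp.Nontrivial →
    ∃ n m : ℕ, 1 ≤ n ∧ 1 ≤ m ∧ Nonempty (C.toSimpleGraph ≃g KB n m)) ∧
  ¬ ∃ m : ℕ, 1 ≤ m ∧ Nonempty (G ≃g (K 1 ⊕g KB 1 m))

/-- `G` is the union of `t ≥ 4` copies of `K_2`. -/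
def IsMatchingFamily {V : Type u} (G : SimpleGraph V) : Prop :=
  ∃ t : ℕ, 4 ≤ t ∧ Nonempty (G ≃g disjointUnion (fun _ : Fin t => K 2))

/-- `G` is the union of `t ≥ 3` stars `K_{1,m_i}`, `m_i ≥ 1`, with some `m_i ≥ 2`. -/
def IsManyStarsFamily {V : Type u} (G : SimpleGraph V) : Prop :=
  ∃ (t : ℕ) (m : Fin t → ℕ), 3 ≤ t ∧ (∀ i, 1 ≤ m i) ∧ (∃ i, 2 ≤ m i) ∧
    Nonempty (G ≃g disjointUnion (fun i : Fin t => KB 1 (m i)))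

/-- `G ≃ K_{1,m₁} ∪ K_{1,m₂}` with `m₁, m₂ ≥ 2`. -/
def IsTwoStarsFamily {V : Type u} (G : SimpleGraph V) : Prop :=
  ∃ m₁ m₂ : ℕ, 2 ≤ m₁ ∧ 2 ≤ m₂ ∧ Nonempty (G ≃g (KB 1 m₁ ⊕g KB 1 m₂))

/-- `G` belongs to one of the five families. -/
def IsExceptional {V : Type u} (G : SimpleGraph V) : Prop :=
  IsCompleteFamily G ∨ IsIsolatedFamily G ∨ IsMatchingFamily G ∨ IsManyStarsFamily G ∨
    IsTwoStarsFamily G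

end ComplementaryPrism

/-! ### Role assignments from a partition into three classes -/

namespace ComplementaryPrism

universe u v

/-! Existence. Almost every assignment uses the role graph 0 - 1 - 2 with a loop at 2 and possibly
one at 1 (`loopedPath`). Choose a small set S for role 0, let T (role 1) be its neighborhood, and
give role 2 to the rest; what remains is to find the neighbors required by
`hasRoleAssignment_of_sets`. The section `Positive` lists useful choices of S, such as a nonadjacent
pair, a single vertex, or the leaves at a vertex together with a vertex of the other copy. Since the
prisms of `G` and `Gᶜ` are isomorphic, each choice also works in complemented form.

If `G` and `Gᶜ` are both connected, some choice always succeeds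
(`prism_role_of_connected_of_compl_connected`): the cases are a leaf in one of the two graphs, an
edge of one of them in no triangle, and all edges of both in triangles. If `G` is disconnected
without isolated vertices, a component that is not a star suffices (`prism_role_of_not_star`). With
an isolated vertex, it suffices that some component with an edge is not complete bipartite
(`prism_role_of_isolated`). The remaining nonexceptional graphs are `K_1 ∪ K_{1,m}`, two stars one
of which is `K_2`, and `3K_2`; only the last needs a different role graph, the triangle.

Nonexistence. The role graph has no vertex without a neighbor other than itself. If `v` is isolated
in `G`, its left copy is a leaf of the prism, so its color has a single neighbor in the role graph;
`not_prismRole_of_isolated` runs through the few graphs left. This covers family (2) and, through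
the complement, family (1). Families (3) to (5) are the star forests with `StarCondition`; there
`not_prismRole_of_starMap` exploits that a left leaf has just two neighbors in the prism, its center
and its own right copy. -/

theorem hasRoleAssignment_of_map {U : Type u} (H : SimpleGraph U) (R : LoopGraph (Fin 3))
    (p : U → Fin 3) (surj : Function.Surjective p)
    (hom : ∀ x y, H.Adj x y → R.Adj (p x) (p y))
    (lift : ∀ x c, R.Adj (p x) c → ∃ y, H.Adj x y ∧ p y = c) : HasRoleAssignment H 3 := by
  refine ⟨R, p, surj, fun x => Set.ext fun c => ⟨?_, ?_⟩⟩
  · rintro ⟨y, hy, rfl⟩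
    exact hom x y hy
  · intro hc
    obtain ⟨y, hy, rfl⟩ := lift x c hc
    exact ⟨y, hy, rfl⟩

/-- The path `0 - 1 - 2` with a loop at `2`, and a loop at `1` if `b` holds. -/
def loopedPath (b : Prop) : LoopGraph (Fin 3) where
  Adj i j := (i = 0 ∧ j = 1) ∨ (i = 1 ∧ j = 0) ∨ (i = 1 ∧ j = 2) ∨ (i = 2 ∧ j = 1) ∨
    (i = 2 ∧ j = 2) ∨ (i = 1 ∧ j = 1 ∧ b)
  symm := by tauto

/-- Colors 0, 1, 2 are S, T and the rest. The last hypothesis makes T uniform, which decides whether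
color 1 carries a loop. -/
theorem hasRoleAssignment_of_sets {U : Type u} (H : SimpleGraph U) (S T : Set U)
    (hne : S.Nonempty) (hST : ∀ x ∈ S, x ∉ T) (hSn : ∀ x ∈ S, ∃ y, H.Adj x y)
    (hS : ∀ x ∈ S, ∀ y, H.Adj x y → y ∈ T)
    (hTS : ∀ x ∈ T, ∃ y ∈ S, H.Adj x y)
    (hTC : ∀ x ∈ T, ∃ y, y ∉ S ∧ y ∉ T ∧ H.Adj x y)
    (hCT : ∀ x, x ∉ S → x ∉ T → ∃ y ∈ T, H.Adj x y)
    (hCC : ∀ x, x ∉ S → x ∉ T → ∃ y, y ∉ S ∧ y ∉ T ∧ H.Adj x y)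
    (hTT : (∀ x ∈ T, ∃ y ∈ T, H.Adj x y) ∨ (∀ x ∈ T, ∀ y ∈ T, ¬ H.Adj x y)) :
    HasRoleAssignment H 3 := by
  classical
  let p : U → Fin 3 := fun x => if x ∈ S then 0 else if x ∈ T then 1 else 2
  have hp0 : ∀ x, x ∈ S → p x = 0 := fun x h => by simp [p, h]
  have hp1 : ∀ x, x ∈ T → p x = 1 := fun x h => by
    have : x ∉ S := fun h' => hST x h' h
    simp [p, h, this]
  have hp2 : ∀ x, x ∉ S → x ∉ T → p x = 2 := fun x h h' => by simp [p, h, h']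
  have hcase : ∀ x, x ∈ S ∨ x ∈ T ∨ (x ∉ S ∧ x ∉ T) := fun x => by tauto
  have hST' : ∀ x ∈ S, ∃ y ∈ T, H.Adj x y := fun x hx => by
    obtain ⟨y, hy⟩ := hSn x hx
    exact ⟨y, hS x hx y hy, hy⟩
  have hTS' : ∀ x y, x ∈ T ∨ (x ∉ S ∧ x ∉ T) → y ∈ S → H.Adj x y → x ∈ T := fun x y _ hy h =>
    hS y hy x h.symm
  refine hasRoleAssignment_of_map H (loopedPath (∀ x ∈ T, ∃ y ∈ T, H.Adj x y)) p ?_ ?_ ?_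
  · obtain ⟨s, hs⟩ := hne
    obtain ⟨t, ht, -⟩ := hST' s hs
    obtain ⟨c, hc, hc', -⟩ := hTC t ht
    intro i
    fin_cases i
    · exact ⟨s, hp0 s hs⟩
    · exact ⟨t, hp1 t ht⟩
    · exact ⟨c, hp2 c hc hc'⟩
  · intro x y h
    rcases hcase x with hx | hx | ⟨hx, hx'⟩
    · simp [loopedPath, hp0 x hx, hp1 y (hS x hx y h)]
    · rcases hcase y with hy | hy | ⟨hy, hy'⟩
      · simp [loopedPath, hp1 x hx, hp0 y hy]
      · rcases hTT with hTT | hTT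
        · simp only [loopedPath, hp1 x hx, hp1 y hy]
          tauto
        · exact absurd h (hTT x hx y hy)
      · simp [loopedPath, hp1 x hx, hp2 y hy hy']
    · rcases hcase y with hy | hy | ⟨hy, hy'⟩
      · exact absurd (hS y hy x h.symm) hx'
      · simp [loopedPath, hp2 x hx hx', hp1 y hy]
      · simp [loopedPath, hp2 x hx hx', hp2 y hy hy']
  · intro x c hc
    rcases hcase x with hx | hx | ⟨hx, hx'⟩
    · obtain ⟨y, hy, h⟩ := hST' x hx
      have : c = 1 := by simpa [loopedPath, hp0 x hx] using hc
      exact ⟨y, h, by rw [hp1 y hy, this]⟩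
    · have : c = 0 ∨ c = 2 ∨ (c = 1 ∧ ∀ x ∈ T, ∃ y ∈ T, H.Adj x y) := by
        simpa only [loopedPath, hp1 x hx, one_ne_zero, false_and, false_or, true_and,
          show (1 : Fin 3) ≠ 2 by decide] using hc
      rcases this with rfl | rfl | ⟨rfl, h⟩
      · obtain ⟨y, hy, h⟩ := hTS x hx
        exact ⟨y, h, hp0 y hy⟩
      · obtain ⟨y, hy, hy', h⟩ := hTC x hx
        exact ⟨y, h, hp2 y hy hy'⟩
      · obtain ⟨y, hy, h⟩ := h x hx
        exact ⟨y, h, hp1 y hy⟩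
    · have : c = 1 ∨ c = 2 := by simpa [loopedPath, hp2 x hx hx'] using hc
      rcases this with rfl | rfl
      · obtain ⟨y, hy, h⟩ := hCT x hx hx'
        exact ⟨y, h, hp1 y hy⟩
      · obtain ⟨y, hy, hy', h⟩ := hCC x hx hx'
        exact ⟨y, h, hp2 y hy hy'⟩

/-! ### Prisms: symmetry under complement, and the partition criterion copy by copy -/

section Prism

variable {V : Type u} (G : SimpleGraph V)

@[simp] theorem prism_adj_inl_inl (x y : V) :
    (prism G).Adj (Sum.inl x) (Sum.inl y) ↔ G.Adj x y := Iff.rfl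

@[simp] theorem prism_adj_inr_inr (x y : V) :
    (prism G).Adj (Sum.inr x) (Sum.inr y) ↔ x ≠ y ∧ ¬ G.Adj x y := SimpleGraph.compl_adj G x y

@[simp] theorem prism_adj_inl_inr (x y : V) :
    (prism G).Adj (Sum.inl x) (Sum.inr y) ↔ x = y := Iff.rfl

@[simp] theorem prism_adj_inr_inl (x y : V) :
    (prism G).Adj (Sum.inr x) (Sum.inl y) ↔ x = y := Iff.rfl

theorem hasRoleAssignment_iso {U : Type u} {W : Type v} {H : SimpleGraph U} {H' : SimpleGraph W}
    (e : H ≃g H') {r : ℕ} (h : HasRoleAssignment H' r) : HasRoleAssignment H r := by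
  obtain ⟨R, p, hs, hp⟩ := h
  refine ⟨R, p ∘ e, hs.comp e.surjective, fun x => ?_⟩
  rw [Function.comp_apply, ← hp (e x)]
  ext c
  constructor
  · rintro ⟨y, hy, rfl⟩
    exact ⟨e y, e.map_adj_iff.2 hy, rfl⟩
  · rintro ⟨y, hy, rfl⟩
    refine ⟨e.symm y, ?_, by simp⟩
    have := e.map_adj_iff (v := x) (w := e.symm y)
    rw [RelIso.apply_symm_apply] at this
    exact this.1 hy

/-- The prism of the complement is the prism with its two copies exchanged. -/
def prismSwap : prism G ≃g prism Gᶜ where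
  toEquiv := Equiv.sumComm V V
  map_rel_iff' := by
    rintro (x | x) (y | y)
    · change (prism Gᶜ).Adj (Sum.inr x) (Sum.inr y) ↔ G.Adj x y
      rw [prism_adj_inr_inr, SimpleGraph.compl_adj]
      constructor
      · tauto
      · intro h
        exact ⟨h.ne, by tauto⟩
    · rfl
    · rfl
    · rfl

theorem prism_compl_role (h : HasRoleAssignment (prism Gᶜ) 3) : HasRoleAssignment (prism G) 3 :=
  hasRoleAssignment_iso (prismSwap G) h

/-- Isomorphic graphs have isomorphic prisms. -/
def prismCongr {W : Type v} {H : SimpleGraph W} (e : G ≃g H) : prism G ≃g prism H where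
  toEquiv := Equiv.sumCongr e.toEquiv e.toEquiv
  map_rel_iff' := by
    rintro (x | x) (y | y)
    · exact e.map_adj_iff
    · exact e.toEquiv.injective.eq_iff
    · exact e.toEquiv.injective.eq_iff
    · change (prism H).Adj (Sum.inr (e x)) (Sum.inr (e y)) ↔ _
      rw [prism_adj_inr_inr, prism_adj_inr_inr, e.map_adj_iff, e.injective.ne_iff]

variable {G}

/-- The partition criterion written out in `G` alone, with C for the third class. In `tLC`, for
instance, a left vertex of T gets a neighbor in C, either its own right copy or a left neighbor. -/
theorem prism_role_of_sets (SL SR TL TR : V → Prop)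
    (ne : ∃ w, SL w ∨ SR w) (dL : ∀ w, SL w → ¬ TL w) (dR : ∀ w, SR w → ¬ TR w)
    (sLL : ∀ s w, SL s → G.Adj s w → TL w) (sLR : ∀ s, SL s → TR s)
    (sRL : ∀ s, SR s → TL s) (sRR : ∀ s w, SR s → s ≠ w → ¬ G.Adj s w → TR w)
    (tLS : ∀ w, TL w → SR w ∨ ∃ s, SL s ∧ G.Adj w s)
    (tRS : ∀ w, TR w → SL w ∨ ∃ s, SR s ∧ w ≠ s ∧ ¬ G.Adj w s)
    (tLC : ∀ w, TL w → (¬ SR w ∧ ¬ TR w) ∨ ∃ c, ¬ SL c ∧ ¬ TL c ∧ G.Adj w c)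
    (tRC : ∀ w, TR w → (¬ SL w ∧ ¬ TL w) ∨ ∃ c, ¬ SR c ∧ ¬ TR c ∧ w ≠ c ∧ ¬ G.Adj w c)
    (cLT : ∀ w, ¬ SL w → ¬ TL w → TR w ∨ ∃ t, TL t ∧ G.Adj w t)
    (cRT : ∀ w, ¬ SR w → ¬ TR w → TL w ∨ ∃ t, TR t ∧ w ≠ t ∧ ¬ G.Adj w t)
    (cLC : ∀ w, ¬ SL w → ¬ TL w → (¬ SR w ∧ ¬ TR w) ∨ ∃ c, ¬ SL c ∧ ¬ TL c ∧ G.Adj w c)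
    (cRC : ∀ w, ¬ SR w → ¬ TR w →
      (¬ SL w ∧ ¬ TL w) ∨ ∃ c, ¬ SR c ∧ ¬ TR c ∧ w ≠ c ∧ ¬ G.Adj w c)
    (tt : ((∀ w, TL w → TR w ∨ ∃ t, TL t ∧ G.Adj w t) ∧
        (∀ w, TR w → TL w ∨ ∃ t, TR t ∧ w ≠ t ∧ ¬ G.Adj w t)) ∨
      ((∀ w, TL w → ¬ TR w) ∧ (∀ w t, TL w → TL t → ¬ G.Adj w t) ∧
        (∀ w t, TR w → TR t → w ≠ t → G.Adj w t))) :
    HasRoleAssignment (prism G) 3 := by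
  have key : ∀ (PL PR : V → Prop) (w : V ⊕ V),
      (∃ y, Sum.elim PL PR y ∧ (prism G).Adj w y) ↔
        Sum.elim (fun w => PR w ∨ ∃ t, PL t ∧ G.Adj w t)
          (fun w => PL w ∨ ∃ t, PR t ∧ w ≠ t ∧ ¬ G.Adj w t) w := by
    rintro PL PR (w | w)
    · simp [Sum.exists, or_comm]
    · simp [Sum.exists]
  have keyC : ∀ w : V ⊕ V,
      (∃ y, y ∉ {z | Sum.elim SL SR z} ∧ y ∉ {z | Sum.elim TL TR z} ∧ (prism G).Adj w y) ↔
        Sum.elim (fun w => (¬ SR w ∧ ¬ TR w) ∨ ∃ c, ¬ SL c ∧ ¬ TL c ∧ G.Adj w c)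
          (fun w => (¬ SL w ∧ ¬ TL w) ∨ ∃ c, ¬ SR c ∧ ¬ TR c ∧ w ≠ c ∧ ¬ G.Adj w c) w := by
    rintro (w | w)
    · simp [Sum.exists, or_comm]
    · simp [Sum.exists]
  refine hasRoleAssignment_of_sets (prism G) {z | Sum.elim SL SR z} {z | Sum.elim TL TR z}
    ?_ ?_ ?_ ?_ ?_ ?_ ?_ ?_ ?_
  · obtain ⟨w, h | h⟩ := ne
    · exact ⟨Sum.inl w, h⟩
    · exact ⟨Sum.inr w, h⟩
  · rintro (w | w) h
    · exact dL w h
    · exact dR w h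
  · rintro (w | w) -
    · exact ⟨Sum.inr w, rfl⟩
    · exact ⟨Sum.inl w, rfl⟩
  · rintro (w | w) h (y | y) hy
    · exact sLL w y h hy
    · obtain rfl : w = y := hy
      exact sLR w h
    · obtain rfl : w = y := hy
      exact sRL w h
    · rw [prism_adj_inr_inr] at hy
      exact sRR w y h hy.1 hy.2
  · rintro (w | w) h
    · exact (key SL SR _).2 (tLS w h)
    · exact (key SL SR _).2 (tRS w h)
  · rintro (w | w) h
    · exact (keyC _).2 (tLC w h)
    · exact (keyC _).2 (tRC w h)
  · rintro (w | w) h h'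
    · exact (key TL TR _).2 (cLT w h h')
    · exact (key TL TR _).2 (cRT w h h')
  · rintro (w | w) h h'
    · exact (keyC _).2 (cLC w h h')
    · exact (keyC _).2 (cRC w h h')
  · rcases tt with ⟨h1, h2⟩ | ⟨h1, h2, h3⟩
    · left
      rintro (w | w) h
      · exact (key TL TR _).2 (h1 w h)
      · exact (key TL TR _).2 (h2 w h)
    · right
      rintro (w | w) h (y | y) h' hy
      · exact h2 w y h h' hy
      · obtain rfl : w = y := hy
        exact h1 w h h'
      · obtain rfl : w = y := hy
        exact h1 w h' h
      · rw [prism_adj_inr_inr] at hy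
        exact hy.2 (h3 w y h h' hy.1)

end Prism

/-! ### Choices of the class S that give role assignments -/

section Positive

variable {V : Type u} {G : SimpleGraph V}

/-- S consists of the left copies of `x` and `y`. Their right copies are adjacent and `hdom` handles
the left part of T, so color 1 has a loop. -/
theorem prism_role_of_nonadj_pair {x y : V} (hxy : x ≠ y) (hn : ¬ G.Adj x y)
    (hx : ∃ w, w ≠ x ∧ w ≠ y ∧ ¬ G.Adj x w) (hy : ∃ w, w ≠ x ∧ w ≠ y ∧ ¬ G.Adj y w)
    (hdom : ∀ w, w ≠ x → w ≠ y → ∃ a, (G.Adj a x ∨ G.Adj a y) ∧ G.Adj w a)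
    (hA : ∀ a, (G.Adj a x ∨ G.Adj a y) → ∃ w, w ≠ x ∧ w ≠ y ∧ w ≠ a ∧ ¬ G.Adj a w) :
    HasRoleAssignment (prism G) 3 := by
  have sym : ∀ a b, G.Adj a b → G.Adj b a := fun a b h => h.symm
  have irr : ∀ a, ¬ G.Adj a a := fun a => G.irrefl
  refine prism_role_of_sets (fun w => w = x ∨ w = y) (fun _ => False)
    (fun w => G.Adj w x ∨ G.Adj w y) (fun w => w = x ∨ w = y)
    ⟨x, by simp⟩ ?dL ?dR ?sLL ?sLR ?sRL ?sRR ?tLS ?tRS ?tLC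
    ?tRC ?cLT ?cRT ?cLC ?cRC (Or.inl ⟨?ttL, ?ttR⟩)
  case cLT => exact fun w h _ => Or.inr (hdom w (by tauto) (by tauto))
  case ttL => exact fun w h => Or.inr (hdom w (by grind) (by grind))
  all_goals grind

/-- S is the left copy of `x`; `hind` makes T independent, so color 1 has no loop. -/
theorem prism_role_of_single {x : V} (hN : ∃ a, G.Adj x a)
    (hind : ∀ a b, G.Adj x a → G.Adj x b → ¬ G.Adj a b)
    (hdist : ∀ w, w ≠ x → ¬ G.Adj x w → ∃ a, G.Adj x a ∧ G.Adj a w)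
    (hw : ∃ w, w ≠ x ∧ ¬ G.Adj x w)
    (hA : ∀ a, G.Adj x a → ∃ b, b ≠ x ∧ b ≠ a ∧ ¬ G.Adj a b) :
    HasRoleAssignment (prism G) 3 := by
  have sym : ∀ a b, G.Adj a b → G.Adj b a := fun a b h => h.symm
  have irr : ∀ a, ¬ G.Adj a a := fun a => G.irrefl
  refine prism_role_of_sets (fun w => w = x) (fun _ => False)
    (fun w => G.Adj w x) (fun w => w = x)
    ⟨x, by simp⟩ ?dL ?dR ?sLL ?sLR ?sRL ?sRR ?tLS ?tRS ?tLC
    ?tRC ?cLT ?cRT ?cLC ?cRC (Or.inr ⟨?ttD, ?ttL, ?ttR⟩)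
  all_goals grind

/-- S consists of all left leaves at `z` and the right copy of `y`. Both copies of `t` have color 2
and serve the left `y` and the right `z`; the vertex from `hM` gives the right copy of `x` a
neighbor in T. -/
theorem prism_role_of_leaf {x y z t : V} (hiso : ∀ w, ∃ w', G.Adj w w')
    (hxz : G.Adj x z) (hleaf : ∀ w, G.Adj x w → w = z) (hyz : G.Adj y z) (hyt : G.Adj y t)
    (htz : t ≠ z) (hzt : ¬ G.Adj z t) (hM : ∃ m, m ≠ x ∧ m ≠ y ∧ ¬ G.Adj y m) :
    HasRoleAssignment (prism G) 3 := by
  have sym : ∀ a b, G.Adj a b → G.Adj b a := fun a b h => h.symm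
  have irr : ∀ a, ¬ G.Adj a a := fun a => G.irrefl
  refine prism_role_of_sets (fun w => G.Adj z w ∧ ∀ u, G.Adj w u → u = z) (fun w => w = y)
    (fun w => w = z ∨ w = y)
    (fun w => (G.Adj z w ∧ ∀ u, G.Adj w u → u = z) ∨ (w ≠ y ∧ ¬ G.Adj y w))
    ⟨y, by simp⟩ ?dL ?dR ?sLL ?sLR ?sRL ?sRR ?tLS ?tRS ?tLC
    ?tRC ?cLT ?cRT ?cLC ?cRC (Or.inl ⟨?ttL, ?ttR⟩)
  all_goals grind

/-- On the right, S is `x` and `y`; on the left it contains `v`. The right copy of `v` lies in T and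
is adjacent to its whole copy, which makes most conditions automatic; `m` is its own neighbor in T.
-/
theorem prism_role_of_isolated_triangle {v x y z m : V} (hv : ∀ w, ¬ G.Adj v w)
    (hxy : G.Adj x y) (hxz : G.Adj x z) (hyz : G.Adj y z)
    (hm : m ≠ v ∧ m ≠ x ∧ m ≠ y ∧ ¬ (G.Adj m x ∧ G.Adj m y)) :
    HasRoleAssignment (prism G) 3 := by
  have sym : ∀ a b, G.Adj a b → G.Adj b a := fun a b h => h.symm
  have irr : ∀ a, ¬ G.Adj a a := fun a => G.irrefl
  refine prism_role_of_sets
    (fun w => w ≠ x ∧ w ≠ y ∧ ¬ (G.Adj w x ∧ G.Adj w y) ∧ ∀ u, G.Adj w u → u = x ∨ u = y)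
    (fun w => w = x ∨ w = y) (fun w => w = x ∨ w = y)
    (fun w => w ≠ x ∧ w ≠ y ∧ ¬ (G.Adj w x ∧ G.Adj w y))
    ⟨x, by simp⟩ ?dL ?dR ?sLL ?sLR ?sRL ?sRR ?tLS ?tRS ?tLC
    ?tRC ?cLT ?cRT ?cLC ?cRC (Or.inl ⟨?ttL, ?ttR⟩)
  case cRT =>
    intro w h1 h2
    by_cases h : w = x ∨ w = y
    · exact Or.inl h
    · exact Or.inr ⟨v, by grind⟩
  case ttR =>
    intro w h
    by_cases hwv : w = v
    · exact Or.inr ⟨m, by grind⟩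
    · exact Or.inr ⟨v, by grind⟩
  all_goals grind

/-- S consists of the left vertices whose neighborhood lies in that of `x`, among them `x` and `v`,
and the right copy of `y`. By `hA`, a neighbor of `x` not adjacent to `y` still has a neighbor of
color 2. -/
theorem prism_role_of_isolated_path {v x y z t : V} (hv : ∀ w, ¬ G.Adj v w)
    (htri : ∀ a b c, G.Adj a b → G.Adj b c → ¬ G.Adj a c)
    (hxz : G.Adj x z) (hyz : G.Adj y z) (hyt : G.Adj y t) (hxt : ¬ G.Adj x t)
    (hA : ∀ a, G.Adj x a → ¬ G.Adj y a → ∃ w u, G.Adj a w ∧ G.Adj w u ∧ ¬ G.Adj x u) :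
    HasRoleAssignment (prism G) 3 := by
  have sym : ∀ a b, G.Adj a b → G.Adj b a := fun a b h => h.symm
  have irr : ∀ a, ¬ G.Adj a a := fun a => G.irrefl
  refine prism_role_of_sets
    (fun w => ∀ u, G.Adj w u → G.Adj x u)
    (fun w => w = y) (fun w => G.Adj x w ∨ w = y)
    (fun w => (∀ u, G.Adj w u → G.Adj x u) ∨ (w ≠ y ∧ ¬ G.Adj y w))
    ⟨y, by simp⟩ ?dL ?dR ?sLL ?sLR ?sRL ?sRR ?tLS ?tRS ?tLC
    ?tRC ?cLT ?cRT ?cLC ?cRC (Or.inl ⟨?ttL, ?ttR⟩)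
  case ttR =>
    intro w h
    by_cases hwv : w = v
    · exact Or.inr ⟨x, by grind⟩
    · exact Or.inr ⟨v, by grind⟩
  all_goals grind

theorem prism_role_of_isolated_universal {v y c : V} (hv : ∀ w, ¬ G.Adj v w)
    (hvy : v ≠ y) (hy : ∀ w, w ≠ v → w ≠ y → G.Adj y w) (hc : c ≠ v ∧ c ≠ y) :
    HasRoleAssignment (prism G) 3 := by
  have sym : ∀ a b, G.Adj a b → G.Adj b a := fun a b h => h.symm
  have irr : ∀ a, ¬ G.Adj a a := fun a => G.irrefl
  refine prism_role_of_sets (fun w => w = v) (fun w => w = y) (fun w => w = y) (fun w => w = v)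
    ⟨y, by simp⟩ ?dL ?dR ?sLL ?sLR ?sRL ?sRR ?tLS ?tRS ?tLC
    ?tRC ?cLT ?cRT ?cLC ?cRC (Or.inr ⟨?ttD, ?ttL, ?ttR⟩)
  case tLC => exact fun w h => Or.inr ⟨c, by grind⟩
  case tRC => exact fun w h => Or.inr ⟨c, by grind⟩
  all_goals grind

/-- S takes the path's ends on the left and its middle on the right, T the reverse; every other
vertex, such as `c`, has color 2 in both copies. -/
theorem prism_role_of_path_join {x z y w c : V} (hxz : G.Adj x z) (hzy : G.Adj z y)
    (hyw : G.Adj y w) (hx : ∀ u, G.Adj x u → u = z) (hw : ∀ u, G.Adj w u → u = y)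
    (hxy : x ≠ y) (hzw : z ≠ w)
    (hz : ∀ u, u ≠ z → u ≠ w → G.Adj z u) (hy : ∀ u, u ≠ y → u ≠ x → G.Adj y u)
    (hc : c ≠ x ∧ c ≠ z ∧ c ≠ y ∧ c ≠ w) :
    HasRoleAssignment (prism G) 3 := by
  have sym : ∀ a b, G.Adj a b → G.Adj b a := fun a b h => h.symm
  have irr : ∀ a, ¬ G.Adj a a := fun a => G.irrefl
  refine prism_role_of_sets (fun u => u = x ∨ u = w) (fun u => u = z ∨ u = y)
    (fun u => u = z ∨ u = y) (fun u => u = x ∨ u = w)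
    ⟨y, by simp⟩ ?dL ?dR ?sLL ?sLR ?sRL ?sRR ?tLS ?tRS ?tLC
    ?tRC ?cLT ?cRT ?cLC ?cRC (Or.inl ⟨?ttL, ?ttR⟩)
  case tLC => exact fun u h => Or.inr ⟨c, by grind⟩
  case tRC => exact fun u h => Or.inr ⟨c, by grind⟩
  case cRT =>
    intro u h1 h2
    by_cases h : u = z ∨ u = y
    · exact Or.inl h
    · exact Or.inr ⟨x, by grind⟩
  case ttR =>
    rintro u (rfl | rfl)
    · exact Or.inr ⟨w, by grind⟩
    · exact Or.inr ⟨x, by grind⟩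
  all_goals grind

end Positive

/-! ### Both the graph and its complement connected -/

section Connected

variable {V : Type u} {G : SimpleGraph V}

/-- The nonadjacent-pair construction in `Gᶜ`. A vertex `a` outside the edge that is not adjacent to
both ends is a `Gᶜ`-neighbor of one of them. -/
theorem prism_role_of_edge {x y : V} (hxy : G.Adj x y) (hx : ∃ w, w ≠ y ∧ G.Adj x w)
    (hy : ∃ w, w ≠ x ∧ G.Adj y w)
    (hdom : ∀ w, w ≠ x → w ≠ y →
      ∃ a, a ≠ x ∧ a ≠ y ∧ ¬ (G.Adj a x ∧ G.Adj a y) ∧ w ≠ a ∧ ¬ G.Adj w a)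
    (hA : ∀ a, a ≠ x → a ≠ y → ¬ (G.Adj a x ∧ G.Adj a y) → ∃ w, w ≠ x ∧ w ≠ y ∧ G.Adj a w) :
    HasRoleAssignment (prism G) 3 := by
  have sym : ∀ a b, G.Adj a b → G.Adj b a := fun a b h => h.symm
  have irr : ∀ a, ¬ G.Adj a a := fun a => G.irrefl
  apply prism_compl_role
  refine prism_role_of_nonadj_pair (x := x) (y := y) hxy.ne ?_ ?_ ?_ ?_ ?_ <;>
    simp only [SimpleGraph.compl_adj]
  · grind
  · grind
  · grind
  · intro w h1 h2
    obtain ⟨a, ha⟩ := hdom w h1 h2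
    exact ⟨a, by grind⟩
  · intro a ha
    obtain ⟨w, hw⟩ := hA a (by grind) (by grind) (by grind)
    exact ⟨w, by grind⟩

theorem prism_role_of_compl_single {x : V} (hN : ∃ a, a ≠ x ∧ ¬ G.Adj x a)
    (hcl : ∀ a b, a ≠ x → b ≠ x → ¬ G.Adj x a → ¬ G.Adj x b → a ≠ b → G.Adj a b)
    (hdist : ∀ w, G.Adj x w → ∃ a, a ≠ x ∧ ¬ G.Adj x a ∧ ¬ G.Adj a w)
    (hw : ∃ w, G.Adj x w)
    (hA : ∀ a, a ≠ x → ¬ G.Adj x a → ∃ b, b ≠ x ∧ G.Adj a b) :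
    HasRoleAssignment (prism G) 3 := by
  have sym : ∀ a b, G.Adj a b → G.Adj b a := fun a b h => h.symm
  have irr : ∀ a, ¬ G.Adj a a := fun a => G.irrefl
  apply prism_compl_role
  refine prism_role_of_single (x := x) ?_ ?_ ?_ ?_ ?_ <;>
    simp only [SimpleGraph.compl_adj] <;> grind +splitImp

theorem reachable_induction {P : V → Prop} (hP : ∀ a b, P a → G.Adj a b → P b) {a b : V}
    (h : G.Reachable a b) (ha : P a) : P b := by
  obtain ⟨p⟩ := h
  induction p with
  | nil => exact ha
  | cons hadj _ ih => exact ih (hP _ _ ha hadj)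

theorem exists_adj_adj_of_reachable {z w : V} (h : G.Reachable z w) (hne : w ≠ z)
    (hn : ¬ G.Adj z w) : ∃ y t, G.Adj z y ∧ G.Adj y t ∧ t ≠ z ∧ ¬ G.Adj z t := by
  by_contra! hcon
  have : w = z ∨ G.Adj z w := by
    refine reachable_induction (P := fun w => w = z ∨ G.Adj z w) ?_ h (Or.inl rfl)
    rintro a b (rfl | ha) hab
    · exact Or.inr hab
    · by_cases hb : b = z
      · exact Or.inl hb
      · exact Or.inr (hcon a b ha hab hb)
  tauto

theorem exists_adj_of_connected [Nontrivial V] (h : G.Connected) (w : V) : ∃ w', G.Adj w w' := by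
  obtain ⟨w', hne⟩ := exists_ne w
  obtain ⟨p⟩ := h.preconnected w w'
  cases p with
  | nil => exact absurd rfl hne
  | cons hadj _ => exact ⟨_, hadj⟩

theorem exists_nonadj_of_compl_connected [Nontrivial V] (h : Gᶜ.Connected) (w : V) :
    ∃ w', w ≠ w' ∧ ¬ G.Adj w w' := by
  obtain ⟨w', hw⟩ := exists_adj_of_connected h w
  exact ⟨w', by simpa [SimpleGraph.compl_adj] using hw⟩

/-- Since `z` is not universal there is a path `z`, `y`, `t` with `t` not adjacent to `z`. Whenever
`prism_role_of_leaf` fails for one leaf, it tends to apply to another leaf or in the complement;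
repeated failure pins down the graph. -/
theorem prism_role_of_connected_leaf [Nontrivial V] (hG : G.Connected) (hGc : Gᶜ.Connected)
    {x z : V} (hxz : G.Adj x z) (hleaf : ∀ w, G.Adj x w → w = z) :
    HasRoleAssignment (prism G) 3 := by
  have sym : ∀ a b, G.Adj a b → G.Adj b a := fun a b h => h.symm
  have irr : ∀ a, ¬ G.Adj a a := fun a => G.irrefl
  have hn := exists_adj_of_connected hG
  have hnc := exists_nonadj_of_compl_connected hGc
  obtain ⟨w, hw, hw'⟩ := hnc z
  obtain ⟨y, t, hzy, hyt, htz, hzt⟩ :=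
    exists_adj_adj_of_reachable (hG.preconnected z w) hw.symm hw'
  by_cases hM : ∃ m, m ≠ x ∧ m ≠ y ∧ ¬ G.Adj y m
  · exact prism_role_of_leaf hn hxz hleaf hzy.symm hyt htz hzt hM
  -- Now `y` is adjacent to everything except `x`, so it is a leaf at `x` in `Gᶜ`.
  by_cases hU : ∃ t' m, t' ≠ z ∧ t' ≠ x ∧ ¬ G.Adj z t' ∧ G.Adj t' m ∧ m ≠ y
  · obtain ⟨t', m, h1, h2, h3, h4, h5⟩ := hU
    apply prism_compl_role
    refine prism_role_of_leaf (x := y) (z := x) (y := t') (t := z)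
      (exists_adj_of_connected hGc) ?_ ?_ ?_ ?_ ?_ ?_ ⟨m, ?_⟩ <;>
      (try simp only [SimpleGraph.compl_adj]) <;> grind +splitImp
  -- Now every nonneighbor of `z` other than `z` itself is a leaf at `y`.
  by_cases hU2 : ∃ t', t' ≠ t ∧ t' ≠ z ∧ ¬ G.Adj z t'
  · obtain ⟨t', h1, h2, h3⟩ := hU2
    exact prism_role_of_leaf (x := t) (z := y) (y := z) (t := x) hn hyt.symm
      (by grind +splitImp) hzy hxz.symm (by grind +splitImp) (by grind +splitImp) ⟨t', by grind +splitImp⟩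
  by_cases hc : ∃ c, c ≠ x ∧ c ≠ z ∧ c ≠ y ∧ c ≠ t
  · obtain ⟨c, hc⟩ := hc
    clear hn hnc
    exact prism_role_of_path_join hxz hzy hyt hleaf (by grind +splitImp) (by grind +splitImp) htz.symm
      (by grind +splitImp) (by grind +splitImp) hc
  -- What remains is the path on four vertices.
  · have hcov : ∀ c, c = x ∨ c = z ∨ c = y ∨ c = t := by
      by_contra! h
      exact hc h
    clear hn hnc hU hM hU2 hc
    refine prism_role_of_single (x := z) ⟨y, hzy⟩ ?_ (fun w h1 h2 => ⟨y, ?_⟩) ⟨t, by grind⟩ ?_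
    · intro a b ha hb
      rcases hcov a with rfl | rfl | rfl | rfl <;> rcases hcov b with rfl | rfl | rfl | rfl <;>
        grind
    · have := hcov w
      grind
    · intro a ha
      by_cases hax : a = x
      · exact ⟨y, by grind⟩
      · exact ⟨x, by grind⟩

/-- A vertex meets at most one end of the edge, so minimum degree 2 gives it a neighbor elsewhere.
-/
theorem prism_role_of_edge_not_in_triangle {x y : V}
    (hdeg : ∀ w, ∃ a b, a ≠ b ∧ G.Adj w a ∧ G.Adj w b) (hxy : G.Adj x y)
    (htri : ∀ c, G.Adj x c → ¬ G.Adj y c)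
    (huniv : ¬ ∃ u, u ≠ x ∧ u ≠ y ∧ ∀ w, w ≠ u → w ≠ x → w ≠ y → G.Adj u w) :
    HasRoleAssignment (prism G) 3 := by
  have sym : ∀ a b, G.Adj a b → G.Adj b a := fun a b h => h.symm
  refine prism_role_of_edge hxy ?_ ?_ ?_ ?_
  · obtain ⟨a, b, h⟩ := hdeg x
    clear hdeg
    grind +splitImp
  · obtain ⟨a, b, h⟩ := hdeg y
    clear hdeg
    grind +splitImp
  · intro w h1 h2
    by_contra hcon
    refine huniv ⟨w, h1, h2, ?_⟩
    clear hdeg huniv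
    grind +splitImp
  · intro a _ _ _
    obtain ⟨b, c, h⟩ := hdeg a
    clear hdeg
    grind +splitImp

/-- If the edge itself fails, some `u` is adjacent to all vertices except `x` and `y`. Then the
nonadjacent pairs `u`, `x` and `u`, `y` are tried, and finally another edge. -/
theorem prism_role_of_exists_edge_not_in_triangle {x y : V}
    (hdeg : ∀ w, ∃ a b, a ≠ b ∧ G.Adj w a ∧ G.Adj w b)
    (hdegc : ∀ w, ∃ a b, a ≠ b ∧ w ≠ a ∧ w ≠ b ∧ ¬ G.Adj w a ∧ ¬ G.Adj w b)
    (hxy : G.Adj x y) (htri : ∀ c, G.Adj x c → ¬ G.Adj y c) :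
    HasRoleAssignment (prism G) 3 := by
  have sym : ∀ a b, G.Adj a b → G.Adj b a := fun a b h => h.symm
  have irr : ∀ a, ¬ G.Adj a a := fun a => G.irrefl
  by_cases huniv : ∃ u, u ≠ x ∧ u ≠ y ∧ ∀ w, w ≠ u → w ≠ x → w ≠ y → G.Adj u w
  swap
  · exact prism_role_of_edge_not_in_triangle hdeg hxy htri huniv
  obtain ⟨u, hux, huy, hu⟩ := huniv
  have hux' : ¬ G.Adj u x := by
    obtain ⟨a, b, h⟩ := hdegc u
    clear hdeg hdegc
    grind +splitImp
  have huy' : ¬ G.Adj u y := by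
    obtain ⟨a, b, h⟩ := hdegc u
    clear hdeg hdegc
    grind +splitImp
  have pair : ∀ x y, u ≠ x → u ≠ y → ¬ G.Adj u x → ¬ G.Adj u y →
      (∀ w, w ≠ u → w ≠ x → w ≠ y → G.Adj u w) → G.Adj x y →
      (∀ c, G.Adj x c → ¬ G.Adj y c) →
      (¬ ∃ p, p ≠ u ∧ p ≠ x ∧ p ≠ y ∧ ¬ G.Adj p y ∧
        ∀ w, w ≠ u → w ≠ x → w ≠ y → ¬ G.Adj p w) → HasRoleAssignment (prism G) 3 := by
    intro x y h1 h2 h3 h4 h5 h6 h7 h8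
    refine prism_role_of_nonadj_pair h1 h3 ⟨y, by grind +splitImp⟩ ?_ ?_ ?_
    · obtain ⟨a, b, h⟩ := hdegc x
      clear hdeg hdegc
      grind +splitImp
    · intro w _ _
      by_cases hwy : w = y
      · obtain ⟨a, b, h⟩ := hdeg y
        clear hdeg hdegc
        grind +splitImp
      · clear hdeg hdegc
        grind +splitImp
    · intro a _
      obtain ⟨b, c, h⟩ := hdegc a
      clear hdeg hdegc
      grind +splitImp
  by_cases hp : ∃ p, p ≠ u ∧ p ≠ x ∧ p ≠ y ∧ ¬ G.Adj p y ∧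
      ∀ w, w ≠ u → w ≠ x → w ≠ y → ¬ G.Adj p w
  swap
  · exact pair x y hux huy hux' huy' hu hxy htri hp
  by_cases hq : ∃ p, p ≠ u ∧ p ≠ y ∧ p ≠ x ∧ ¬ G.Adj p x ∧
      ∀ w, w ≠ u → w ≠ y → w ≠ x → ¬ G.Adj p w
  swap
  · exact pair y x huy hux huy' hux' (by grind +splitImp) hxy.symm (by grind +splitImp) hq
  obtain ⟨p, hpu, hpx, hpy, hpy', hp⟩ := hp
  obtain ⟨q, hqu, hqy, hqx, hqx', hq⟩ := hq
  have hpx' : G.Adj p x := by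
    obtain ⟨a, b, h⟩ := hdeg p
    clear hdeg hdegc pair
    grind +splitImp
  have hqy' : G.Adj q y := by
    obtain ⟨a, b, h⟩ := hdeg q
    clear hdeg hdegc pair
    grind +splitImp
  -- Both pairs fail only if `p` has neighbors exactly `u`, `x` and `q` has neighbors exactly `u`,
  -- `y`.
  by_cases hc : ∃ c, c ≠ u ∧ c ≠ x ∧ c ≠ y ∧ c ≠ p ∧ c ≠ q
  · obtain ⟨c, hc⟩ := hc
    refine prism_role_of_edge_not_in_triangle hdeg hpx' ?_ ?_ <;> clear hdeg hdegc pair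
    · grind +splitImp
    · rintro ⟨w, h1, h2, h3⟩
      by_cases hwq : w = q
      · have := h3 c
        grind
      · have := h3 q
        have := h3 y
        have := h3 u
        grind +splitImp
  -- What remains is the 5-cycle `u`, `p`, `x`, `y`, `q`.
  · have hcov : ∀ c, c = u ∨ c = x ∨ c = y ∨ c = p ∨ c = q := by
      by_contra! h
      exact hc h
    clear hdeg hdegc pair hc
    refine prism_role_of_single (x := u) ⟨p, by grind +splitImp⟩ ?_ ?_ ⟨x, by grind +splitImp⟩ ?_
    · intro a b ha hb hab
      have := hcov a
      have := hcov b
      grind +splitImp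
    · intro w h1 h2
      have : w = x ∨ w = y := by
        have := hcov w
        grind +splitImp
      rcases this with rfl | rfl
      · exact ⟨p, by grind +splitImp⟩
      · exact ⟨q, by grind +splitImp⟩
    · intro a ha
      by_cases hap : a = p
      · exact ⟨y, by grind +splitImp⟩
      · have := hcov a
        exact ⟨x, by grind⟩

/-- If nonadjacent vertices always have a common neighbor, any nonadjacent pair works. Otherwise
take `p`, `q` without one: any edge at `p` works, because `q` is a nonneighbor of every vertex
adjacent to both its ends. -/
theorem prism_role_of_edges_in_triangles [Nonempty V]
    (hn : ∀ w, ∃ w', G.Adj w w') (hnc : ∀ w, ∃ w', w ≠ w' ∧ ¬ G.Adj w w')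
    (hT : ∀ a b, G.Adj a b → ∃ c, G.Adj a c ∧ G.Adj b c)
    (hTc : ∀ a b, a ≠ b → ¬ G.Adj a b → ∃ c, a ≠ c ∧ b ≠ c ∧ ¬ G.Adj a c ∧ ¬ G.Adj b c) :
    HasRoleAssignment (prism G) 3 := by
  have sym : ∀ a b, G.Adj a b → G.Adj b a := fun a b h => h.symm
  have irr : ∀ a, ¬ G.Adj a a := fun a => G.irrefl
  by_cases hd : ∀ a b, a ≠ b → ¬ G.Adj a b → ∃ c, G.Adj a c ∧ G.Adj b c
  · obtain ⟨x⟩ := ‹Nonempty V›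
    obtain ⟨y, hxy, hxy'⟩ := hnc x
    refine prism_role_of_nonadj_pair hxy hxy' ?_ ?_ ?_ ?_
    · grind +splitImp
    · grind +splitImp
    · intro w h1 h2
      by_cases hwx : G.Adj w x
      · grind +splitImp
      · obtain ⟨c, hc⟩ := hd w x h1 hwx
        grind +splitImp
    · intro a ha
      by_cases h : G.Adj a x ∧ G.Adj a y
      · obtain ⟨w, hw⟩ := hnc a
        exact ⟨w, by grind +splitImp⟩
      · by_cases hax : G.Adj a x
        · by_cases hay : a = y
          · grind +splitImp
          · obtain ⟨c, hc⟩ := hTc a y hay (by grind +splitImp)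
            exact ⟨c, by grind +splitImp⟩
        · by_cases hax : a = x
          · grind +splitImp
          · obtain ⟨c, hc⟩ := hTc a x hax (by grind +splitImp)
            exact ⟨c, by grind +splitImp⟩
  · push Not at hd
    obtain ⟨p, q, hpq, hpq', hd⟩ := hd
    obtain ⟨y, hpy⟩ := hn p
    obtain ⟨c, hpc, hyc⟩ := hT p y hpy
    refine prism_role_of_edge hpy ⟨c, by grind +splitImp⟩ ⟨c, by grind +splitImp⟩ ?_ ?_
    · intro w h1 h2
      by_cases h : G.Adj w p ∧ G.Adj w y
      · exact ⟨q, by grind +splitImp⟩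
      · by_cases hwp : G.Adj w p
        · obtain ⟨c, hc⟩ := hTc w y h2 (by grind +splitImp)
          exact ⟨c, by grind +splitImp⟩
        · obtain ⟨c, hc⟩ := hTc w p h1 (by grind +splitImp)
          exact ⟨c, by grind +splitImp⟩
    · intro a _ _ _
      obtain ⟨b, hb⟩ := hn a
      obtain ⟨c, hc⟩ := hT a b hb
      grind +splitImp

theorem prism_role_of_connected_of_compl_connected [Nontrivial V] (hG : G.Connected)
    (hGc : Gᶜ.Connected) : HasRoleAssignment (prism G) 3 := by
  have sym : ∀ a b, G.Adj a b → G.Adj b a := fun a b h => h.symm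
  have hn := exists_adj_of_connected hG
  have hnc := exists_nonadj_of_compl_connected hGc
  by_cases hleaf : ∃ x z, G.Adj x z ∧ ∀ w, G.Adj x w → w = z
  · obtain ⟨x, z, hxz, h⟩ := hleaf
    exact prism_role_of_connected_leaf hG hGc hxz h
  by_cases hleafc : ∃ x z, Gᶜ.Adj x z ∧ ∀ w, Gᶜ.Adj x w → w = z
  · obtain ⟨x, z, hxz, h⟩ := hleafc
    exact prism_compl_role G (prism_role_of_connected_leaf hGc (by rwa [compl_compl]) hxz h)
  have hdeg : ∀ w, ∃ a b, a ≠ b ∧ G.Adj w a ∧ G.Adj w b := by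
    intro w
    obtain ⟨a, ha⟩ := hn w
    grind +splitImp
  have hdegc : ∀ w, ∃ a b, a ≠ b ∧ w ≠ a ∧ w ≠ b ∧ ¬ G.Adj w a ∧ ¬ G.Adj w b := by
    simp only [SimpleGraph.compl_adj] at hleafc
    intro w
    obtain ⟨a, ha⟩ := hnc w
    grind +splitImp
  by_cases hT : ∀ a b, G.Adj a b → ∃ c, G.Adj a c ∧ G.Adj b c
  swap
  · push Not at hT
    obtain ⟨x, y, hxy, h⟩ := hT
    exact prism_role_of_exists_edge_not_in_triangle hdeg hdegc hxy h
  by_cases hTc : ∀ a b, a ≠ b → ¬ G.Adj a b → ∃ c, a ≠ c ∧ b ≠ c ∧ ¬ G.Adj a c ∧ ¬ G.Adj b c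
  · exact prism_role_of_edges_in_triangles hn hnc hT hTc
  · push Not at hTc
    obtain ⟨x, y, hxy, hxy', h⟩ := hTc
    apply prism_compl_role
    refine prism_role_of_exists_edge_not_in_triangle (x := x) (y := y) ?_ ?_ ?_ ?_
    · intro w
      obtain ⟨a, b, h⟩ := hdegc w
      exact ⟨a, b, by simp only [SimpleGraph.compl_adj]; tauto⟩
    · intro w
      obtain ⟨a, b, h⟩ := hdeg w
      exact ⟨a, b, by simp only [SimpleGraph.compl_adj]; grind +splitImp [SimpleGraph.Adj.ne]⟩
    · simp only [SimpleGraph.compl_adj]; tauto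
    · simp only [SimpleGraph.compl_adj]; grind +splitImp

end Connected

/-! ### Disconnected graphs: a component that is not a star, or an isolated vertex -/

section Disconnected

variable {V : Type u} {G : SimpleGraph V}

/-- `H` is a union of components, so a vertex outside it is a nonneighbor of everything inside and
conversely. -/
theorem prism_role_of_edge_in_component {H : V → Prop} (hH : ∀ a b, G.Adj a b → (H a ↔ H b))
    {v x y : V} (hv : ¬ H v) (hxH : H x) (hiso : ∀ w, ∃ w', G.Adj w w')
    (hxy : G.Adj x y) (hx : ∃ w, w ≠ y ∧ G.Adj x w) (hy : ∃ w, w ≠ x ∧ G.Adj y w)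
    (hleaf : ∀ w, H w → w ≠ x → w ≠ y → ∃ w', w' ≠ x ∧ w' ≠ y ∧ G.Adj w w')
    (hdom : (∃ h, H h ∧ h ≠ x ∧ h ≠ y ∧ ¬ (G.Adj h x ∧ G.Adj h y)) ∨
      ∀ u, ¬ H u → ∃ u', ¬ H u' ∧ u ≠ u' ∧ ¬ G.Adj u u') :
    HasRoleAssignment (prism G) 3 := by
  have sym : ∀ a b, G.Adj a b → G.Adj b a := fun a b h => h.symm
  have hyH : H y := (hH x y hxy).1 hxH
  refine prism_role_of_edge hxy hx hy ?_ ?_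
  · intro w hwx hwy
    by_cases hw : H w
    · exact ⟨v, by grind⟩
    · rcases hdom with ⟨h, hh⟩ | hdom
      · exact ⟨h, by grind⟩
      · obtain ⟨u', hu⟩ := hdom w hw
        exact ⟨u', by grind⟩
  · intro a hax hay _
    by_cases ha : H a
    · exact hleaf a ha hax hay
    · obtain ⟨b, hb⟩ := hiso a
      exact ⟨b, by grind⟩

/-- An edge avoiding `u` lies in a triangle with `u`. It serves unless `H` is a clique and the
vertices outside have one adjacent to all the others there. -/
theorem prism_role_of_component_universal {H : V → Prop} (hH : ∀ a b, G.Adj a b → (H a ↔ H b))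
    {v u k l : V} (hv : ¬ H v) (hiso : ∀ w, ∃ w', G.Adj w w') (huH : H u)
    (hu : ∀ w, H w → w ≠ u → G.Adj u w) (hkH : H k) (hkl : G.Adj k l) (hku : k ≠ u) (hlu : l ≠ u) :
    HasRoleAssignment (prism G) 3 := by
  have sym : ∀ a b, G.Adj a b → G.Adj b a := fun a b h => h.symm
  have irr : ∀ a, ¬ G.Adj a a := fun a => G.irrefl
  have edge : ∀ x y, H x → G.Adj x y → x ≠ u → y ≠ u →
      ((∃ h, H h ∧ h ≠ x ∧ h ≠ y ∧ ¬ (G.Adj h x ∧ G.Adj h y)) ∨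
        ∀ u, ¬ H u → ∃ u', ¬ H u' ∧ u ≠ u' ∧ ¬ G.Adj u u') →
      (∃ h, H h ∧ h ≠ x ∧ h ≠ y ∧ h ≠ u) → HasRoleAssignment (prism G) 3 := by
    rintro x y h1 h2 h3 h4 h5 ⟨h, h6⟩
    have hyH : H y := (hH x y h2).1 h1
    refine prism_role_of_edge_in_component hH hv h1 hiso h2 ⟨u, by grind⟩ ⟨u, by grind⟩ ?_ h5
    intro w hw hwx hwy
    by_cases hwu : w = u
    · exact ⟨h, by grind⟩
    · exact ⟨u, by grind⟩
  by_cases hcl : ∃ h h', H h ∧ H h' ∧ h ≠ h' ∧ h ≠ u ∧ h' ≠ u ∧ ¬ G.Adj h h'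
  · obtain ⟨h, h', h1, h2, h3, h4, h5, h6⟩ := hcl
    by_cases hn : ∃ m, m ≠ u ∧ G.Adj h m
    · obtain ⟨m, hm, hm'⟩ := hn
      exact edge h m h1 hm' h4 hm (Or.inl ⟨h', by grind⟩) ⟨h', by grind⟩
    · exact edge k l hkH hkl hku hlu (Or.inl ⟨h, by grind⟩) ⟨h, by grind⟩
  by_cases hun : ∀ u, ¬ H u → ∃ u', ¬ H u' ∧ u ≠ u' ∧ ¬ G.Adj u u'
  · have hlH : H l := (hH k l hkl).1 hkH
    refine prism_role_of_edge hkl ⟨u, by grind⟩ ⟨u, by grind⟩ ?_ ?_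
    · intro w hwx hwy
      by_cases hw : H w
      · exact ⟨v, by grind⟩
      · obtain ⟨u', hu⟩ := hun w hw
        exact ⟨u', by grind⟩
    · intro a hax hay ha
      obtain ⟨b, hb⟩ := hiso a
      exact ⟨b, by grind⟩
  · push Not at hun
    obtain ⟨c, hc, hc'⟩ := hun
    have hcl' : ∀ a b, H a → H b → a ≠ b → G.Adj a b := by
      intro a b ha hb hab
      by_contra hn
      exact hcl ⟨a, b, ha, hb, hab, by grind⟩
    -- The nonneighbors of `c` other than itself are exactly the vertices of the clique `H`.
    refine prism_role_of_compl_single (x := c) ⟨u, ?_⟩ ?_ ?_ (hiso c) ?_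
    · grind
    · intro a b h1 h2 h3 h4 h5
      exact hcl' a b (by grind) (by grind) h5
    · intro w hw
      exact ⟨u, by grind⟩
    · intro a h1 h2
      obtain ⟨b, hb⟩ := hiso a
      exact ⟨b, by grind⟩

/-- The walk, whose ends may coincide, shows that the component is no star. Three cases: a vertex
adjacent to the rest of the component, a leaf, or neither; in the last case the edge `yz` works. -/
theorem prism_role_of_not_star (hiso : ∀ w, ∃ w', G.Adj w w') {x y z w v : V}
    (hxy : G.Adj x y) (hyz : G.Adj y z) (hzw : G.Adj z w) (hxz : x ≠ z) (hyw : y ≠ w)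
    (hv : ¬ G.Reachable y v) : HasRoleAssignment (prism G) 3 := by
  have sym : ∀ a b, G.Adj a b → G.Adj b a := fun a b h => h.symm
  have hH : ∀ a b, G.Adj a b → (G.Reachable y a ↔ G.Reachable y b) := fun a b h =>
    ⟨fun h' => h'.trans h.reachable, fun h' => h'.trans h.symm.reachable⟩
  have hyH : G.Reachable y y := SimpleGraph.Reachable.refl y
  have hzH : G.Reachable y z := hyz.reachable
  by_cases hu : ∃ u, G.Reachable y u ∧ ∀ h, G.Reachable y h → h ≠ u → G.Adj u h
  · obtain ⟨u, huH, hu⟩ := hu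
    by_cases huy : u = y
    · exact prism_role_of_component_universal hH hv hiso huH hu hzH hzw
        (huy ▸ hyz.ne.symm) (huy ▸ hyw.symm)
    by_cases huz : u = z
    · exact prism_role_of_component_universal hH hv hiso huH hu hyH hxy.symm
        (huz ▸ hyz.ne) (huz ▸ hxz)
    · exact prism_role_of_component_universal hH hv hiso huH hu hyH hyz
        (Ne.symm huy) (Ne.symm huz)
  have leaf : ∀ p q, G.Reachable y q → G.Adj p q → (∀ w, G.Adj p w → w = q) →
      HasRoleAssignment (prism G) 3 := by
    intro p q hq hpq hp
    have : ∃ h, G.Reachable y h ∧ h ≠ q ∧ ¬ G.Adj q h := by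
      by_contra! hcon
      exact hu ⟨q, hq, hcon⟩
    obtain ⟨h, hh, hhq, hqh⟩ := this
    obtain ⟨r, t, hqr, hrt, htq, hqt⟩ := exists_adj_adj_of_reachable (hq.symm.trans hh) hhq hqh
    have hr : G.Reachable y r := hq.trans hqr.reachable
    refine prism_role_of_leaf hiso hpq hp hqr.symm hrt htq hqt ⟨v, ?_, ?_, ?_⟩
    · rintro rfl
      exact hv ((hH _ _ hpq).2 hq)
    · rintro rfl
      exact hv hr
    · intro hrv
      exact hv ((hH _ _ hrv).1 hr)
  by_cases hleaf : ∃ p q, G.Reachable y q ∧ G.Adj p q ∧ ∀ w, G.Adj p w → w = q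
  · obtain ⟨p, q, h1, h2, h3⟩ := hleaf
    exact leaf p q h1 h2 h3
  have : ∃ h, G.Reachable y h ∧ h ≠ y ∧ ¬ G.Adj y h := by
    by_contra! hcon
    exact hu ⟨y, hyH, hcon⟩
  obtain ⟨h, hh⟩ := this
  by_cases hcov : ∀ w, G.Reachable y w → w ≠ y → w ≠ z → ¬ (G.Adj w y ∧ G.Adj w z) →
      ∃ w', w' ≠ y ∧ w' ≠ z ∧ G.Adj w w'
  · refine prism_role_of_edge hyz ⟨x, hxz, hxy.symm⟩ ⟨w, hyw.symm, hzw⟩ ?_ ?_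
    · intro a hay haz
      by_cases ha : G.Reachable y a
      · exact ⟨v, by grind⟩
      · exact ⟨h, by grind⟩
    · intro a hay haz hn
      by_cases ha : G.Reachable y a
      · exact hcov a ha hay haz hn
      · obtain ⟨b, hb⟩ := hiso a
        exact ⟨b, by grind⟩
  · push Not at hcov
    obtain ⟨p, hp, hpy, hpz, hn, hp'⟩ := hcov
    obtain ⟨q, hq⟩ := hiso p
    refine absurd ⟨p, q, hp.trans hq.reachable, hq, fun w hw => ?_⟩ hleaf
    have := hp' w
    have := hp' q
    clear hiso leaf hleaf hu hp'
    grind +splitImp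

/-- A triangle is used directly. Without triangles, a nonempty neighborhood properly contained in
another makes `hA` of `prism_role_of_isolated_path` vacuous; if there is none, inclusion of nonempty
neighborhoods is equality. -/
theorem prism_role_of_isolated {v a b c d : V} (hv : ∀ w, ¬ G.Adj v w)
    (hab : G.Adj a b) (hbc : G.Adj b c) (hcd : G.Adj c d) (had : ¬ G.Adj a d) :
    HasRoleAssignment (prism G) 3 := by
  have sym : ∀ a b, G.Adj a b → G.Adj b a := fun a b h => h.symm
  by_cases htri : ∀ a b c, G.Adj a b → G.Adj b c → ¬ G.Adj a c
  swap
  · push Not at htri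
    obtain ⟨x, y, z, hxy, hyz, hxz⟩ := htri
    by_cases hm : ∃ m, m ≠ v ∧ m ≠ x ∧ m ≠ y ∧ ¬ (G.Adj m x ∧ G.Adj m y)
    · obtain ⟨m, hm⟩ := hm
      exact prism_role_of_isolated_triangle hv hxy hxz hyz hm
    · refine prism_role_of_isolated_universal (v := v) (y := x) (c := y) hv (by grind) ?_
        (by grind [SimpleGraph.Adj.ne])
      intro w h1 h2
      by_contra hn
      exact hm ⟨w, by grind⟩
  by_cases hcon : ∃ x y z t, (∀ u, G.Adj x u → G.Adj y u) ∧ G.Adj x z ∧ G.Adj y t ∧ ¬ G.Adj x t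
  · obtain ⟨x, y, z, t, h1, h2, h3, h4⟩ := hcon
    exact prism_role_of_isolated_path hv htri h2 (h1 z h2) h3 h4
      (fun e h5 h6 => absurd (h1 e h5) h6)
  · have hcon' : ∀ x y z t, (∀ u, G.Adj x u → G.Adj y u) → G.Adj x z → G.Adj y t → G.Adj x t := by
      intro x y z t h1 h2 h3
      by_contra h4
      exact hcon ⟨x, y, z, t, h1, h2, h3, h4⟩
    refine prism_role_of_isolated_path hv htri hab hbc.symm hcd had ?_
    intro e hae hce
    -- Otherwise each neighbor `w` of `e` has the neighborhood of `a`, so is adjacent to `b`. Hence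
    -- `e` and `b` have equal neighborhoods, and `c` would be adjacent to `e`.
    by_contra! hw
    have hwb : ∀ w, G.Adj e w → G.Adj b w := fun w hew =>
      (hcon' w a e b (fun u hu => hw w u hew hu) hew.symm hab).symm
    exact hce (hcon' e b a c hwb hae.symm hbc).symm

end Disconnected

/-! ### Nonexistence when there is an isolated vertex -/

section Negative

variable {V : Type u} {G : SimpleGraph V}

/-- A role assignment of the prism, given by the colors `l` and `r` of the two copies. -/
structure PrismRole (G : SimpleGraph V) (R : Fin 3 → Fin 3 → Prop) (l r : V → Fin 3) : Prop where
  symm : ∀ i j, R i j → R j i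
  ll : ∀ x y, G.Adj x y → R (l x) (l y)
  lr : ∀ x, R (l x) (r x)
  rr : ∀ x y, x ≠ y → ¬ G.Adj x y → R (r x) (r y)
  liftl : ∀ x i, R (l x) i → r x = i ∨ ∃ y, G.Adj x y ∧ l y = i
  liftr : ∀ x i, R (r x) i → l x = i ∨ ∃ y, x ≠ y ∧ ¬ G.Adj x y ∧ r y = i
  surj : ∀ i, ∃ x, l x = i ∨ r x = i

theorem exists_prismRole (h : HasRoleAssignment (prism G) 3) :
    ∃ R l r, PrismRole G R l r := by
  obtain ⟨R, p, hs, hp⟩ := h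
  have hom : ∀ x y, (prism G).Adj x y → R.Adj (p x) (p y) := fun x y hxy => by
    have : p y ∈ R.neighborSet (p x) := hp x ▸ ⟨y, hxy, rfl⟩
    exact this
  have lift : ∀ x i, R.Adj (p x) i → ∃ y, (prism G).Adj x y ∧ p y = i := fun x i hi => by
    have : i ∈ p '' (prism G).neighborSet x := hp x ▸ hi
    exact this
  refine ⟨R.Adj, fun x => p (Sum.inl x), fun x => p (Sum.inr x), R.symm,
    fun x y h => hom _ _ h, fun x => hom _ _ rfl, fun x y h h' => hom _ _ ?_, ?_, ?_, ?_⟩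
  · rw [prism_adj_inr_inr]
    exact ⟨h, h'⟩
  · intro x i hi
    obtain ⟨y | y, hy, rfl⟩ := lift _ _ hi
    · exact Or.inr ⟨y, hy, rfl⟩
    · obtain rfl : x = y := hy
      exact Or.inl rfl
  · intro x i hi
    obtain ⟨y | y, hy, rfl⟩ := lift _ _ hi
    · obtain rfl : x = y := hy
      exact Or.inl rfl
    · rw [prism_adj_inr_inr] at hy
      exact Or.inr ⟨y, hy.1, hy.2, rfl⟩
  · intro i
    obtain ⟨x | x, rfl⟩ := hs i
    · exact ⟨x, Or.inl rfl⟩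
    · exact ⟨x, Or.inr rfl⟩

variable {R : Fin 3 → Fin 3 → Prop} {l r : V → Fin 3}

/-- The prism is connected, so a color with no other neighbor would be the only color. -/
theorem PrismRole.exists_adj_ne (h : PrismRole G R l r) (i : Fin 3) : ∃ j, j ≠ i ∧ R i j := by
  by_contra! hcon
  have hi : ∀ j, R i j → j = i := fun j hj => by
    by_contra hne
    exact hcon j hne hj
  have hi' : ∀ j, R j i → j = i := fun j hj => hi j (h.symm _ _ hj)
  have hlr : ∀ x, l x = i ↔ r x = i := fun x =>
    ⟨fun hx => hi _ (hx ▸ h.lr x), fun hx => hi' _ (hx ▸ h.lr x)⟩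
  obtain ⟨x, hx⟩ := h.surj i
  have hx : l x = i := hx.elim id (hlr x).2
  have all : ∀ y, l y = i := by
    intro y
    by_cases hxy : G.Adj x y
    · exact hi _ (hx ▸ h.ll x y hxy)
    · by_cases hne : x = y
      · exact hne ▸ hx
      · exact (hlr y).2 (hi _ ((hlr x).1 hx ▸ h.rr x y hne hxy))
  obtain ⟨j, hj⟩ : ∃ j : Fin 3, j ≠ i := exists_ne i
  obtain ⟨y, hy⟩ := h.surj j
  rcases hy with hy | hy
  · exact hj (hy ▸ all y)
  · exact hj (hy ▸ (hlr y).1 (all y))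

/-- The ends of a walk of length three are adjacent; equivalently, every component is a single
vertex or complete bipartite. -/
def WalkThreeClosed (G : SimpleGraph V) : Prop :=
  ∀ a b c d, G.Adj a b → G.Adj b c → G.Adj c d → G.Adj a d

theorem fin_three_cases {a b c : Fin 3} (hab : a ≠ b) (hac : a ≠ c) (hbc : b ≠ c) (i : Fin 3) :
    i = a ∨ i = b ∨ i = c := by omega

/-- The leaf `v` forces the role graph to be a path `a` - `b` - `c`, loops possible only at `b` and
`c`. Lifts yield walks of length three in `G`, which `hG` closes into forbidden edges. `hex`
excludes `K_1 ∪ K_{1,m}`. -/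
theorem not_prismRole_of_isolated (hG : WalkThreeClosed G) {v : V} (hv : ∀ w, ¬ G.Adj v w)
    (hex : ∀ x, x ≠ v → (∀ y, y ≠ v → y ≠ x → G.Adj x y) → ∀ y, y = v ∨ y = x) :
    ¬ PrismRole G R l r := by
  intro h
  have sym : ∀ a b, G.Adj a b → G.Adj b a := fun a b h => h.symm
  have irr : ∀ a, ¬ G.Adj a a := fun a => G.irrefl
  have ha : ∀ i, R (l v) i → i = r v := by
    intro i hi
    rcases h.liftl v i hi with h' | ⟨y, hy, -⟩
    · exact h'.symm
    · exact absurd hy (hv y)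
  have hvb : ∀ x, x ≠ v → R (r v) (r x) := fun x hx => h.rr v x hx.symm (hv x)
  have hvx : ∀ x y, G.Adj x y → x ≠ v := by
    rintro x y hxy rfl
    exact hv y hxy
  have hlv := h.lr v
  obtain ⟨b, hb⟩ : ∃ b, r v = b := ⟨_, rfl⟩
  obtain ⟨a, haa⟩ : ∃ a, l v = a := ⟨_, rfl⟩
  rw [haa, hb] at ha hlv
  rw [hb] at hvb
  have hab : a ≠ b := by
    rintro rfl
    obtain ⟨j, hj, hj'⟩ := h.exists_adj_ne a
    exact hj (ha j hj')
  obtain ⟨c, hac, hbc⟩ : ∃ c : Fin 3, a ≠ c ∧ b ≠ c := by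
    clear * - hab
    revert a b
    decide
  have hcol := fin_three_cases hab hac hbc
  have hRac : ¬ R a c := fun h' => hbc (ha c h').symm
  have hRaa : ¬ R a a := fun h' => hab (ha a h')
  have hRba := h.symm _ _ hlv
  have hRbc : R b c := by
    obtain ⟨j, hj, hj'⟩ := h.exists_adj_ne c
    rcases hcol j with rfl | rfl | rfl
    · exact absurd (h.symm _ _ hj') hRac
    · exact h.symm _ _ hj'
    · exact absurd rfl hj
  have hRcb := h.symm _ _ hRbc
  have hRca : ¬ R c a := fun h' => hRac (h.symm _ _ h')
  by_cases hRbb : R b b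
  · obtain ⟨β, hβv, hβ⟩ : ∃ β, v ≠ β ∧ r β = c := by
      rcases h.liftr v c (hb ▸ hRbc) with h' | ⟨y, h1, -, h2⟩
      · exact absurd (haa.symm.trans h') hac
      · exact ⟨y, h1, h2⟩
    by_cases hRcc : R c c
    -- If `a` occurs on the right, lifting gives a triangle or an edge colored `a`, `c`; otherwise
    -- it gives an edge colored `a`, `a`.
    · by_cases hr : ∃ y, r y = a
      · obtain ⟨y, hy⟩ := hr
        have key : ∀ y, r y = a → G.Adj y β := by
          intro y hy
          by_contra hn
          have : y ≠ β := by
            rintro rfl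
            exact hac (hy.symm.trans hβ)
          exact hRac (hy ▸ hβ ▸ h.rr y β this hn)
        have hly : l y = b := ha _ (h.symm _ _ (hy ▸ h.lr y))
        have h1 := h.liftl y b (hly ▸ hRbb)
        have h2 := h.liftl y c (hly ▸ hRbc)
        rw [hy] at h1 h2
        obtain ⟨p, hyp, hp⟩ := h1.resolve_left hab
        obtain ⟨p', hyp', hp'⟩ := h2.resolve_left hac
        rcases h.liftl p a (hp ▸ hRba) with h3 | ⟨q, hpq, hq⟩
        · exact irr _ (hG _ _ _ _ (key y hy).symm hyp (key p h3))
        · exact hRac (hq ▸ hp' ▸ h.ll _ _ (hG _ _ _ _ hpq.symm hyp.symm hyp'))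
      · have hr' : ∀ y, r y ≠ a := fun y hy => hr ⟨y, hy⟩
        have hla : ∀ q, l q = b → ∃ i, G.Adj q i ∧ l i = a := fun q hq =>
          (h.liftl q a (hq ▸ hRba)).resolve_left (hr' q)
        have hq : ∃ q, l q = b := by
          have hlβ := h.lr β
          rw [hβ] at hlβ
          rcases hcol (l β) with h1 | h1 | h1
          · exact absurd (h1 ▸ hlβ) hRac
          · exact ⟨β, h1⟩
          · obtain ⟨q, -, hq⟩ := (h.liftl β b (h1 ▸ hRcb)).resolve_left
              (fun h' => hbc (h'.symm.trans hβ))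
            exact ⟨q, hq⟩
        obtain ⟨q, hq⟩ := hq
        have hrq : r q ≠ b := by
          intro h1
          rcases h.liftr q a (h1 ▸ hRba) with h2 | ⟨y, -, -, h2⟩
          · exact hab (h2.symm.trans hq)
          · exact hr' y h2
        obtain ⟨q', hqq, hq'⟩ := (h.liftl q b (hq ▸ hRbb)).resolve_left hrq
        obtain ⟨i, hqi, hi⟩ := hla q hq
        obtain ⟨i', hqi', hi'⟩ := hla q' hq'
        have := h.ll _ _ (hG _ _ _ _ hqi.symm hqq hqi')
        exact hRaa (by rwa [hi, hi'] at this)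
    · have hc : ∀ i, R c i → i = b := by
        intro i hi
        rcases hcol i with rfl | rfl | rfl
        · exact absurd hi hRca
        · rfl
        · exact absurd hi hRcc
      have key : ∀ w, r w = c → l w = b ∧ ∃ z, G.Adj w z ∧ l z = a := by
        intro w hw
        have hlw : l w = b := hc _ (h.symm _ _ (hw ▸ h.lr w))
        exact ⟨hlw, (h.liftl w a (hlw ▸ hRba)).resolve_left (fun h' => hac (h'.symm.trans hw))⟩
      obtain ⟨-, z, hβz, hz⟩ := key β hβ
      have hrz : r z = b := ha _ (hz ▸ h.lr z)
      obtain ⟨w, hzw, hzw', hw⟩ := (h.liftr z c (hrz ▸ hRbc)).resolve_left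
        (fun h' => hac (hz.symm.trans h'))
      have hwβ : w ≠ β := by
        rintro rfl
        exact hzw' hβz.symm
      have hadj : G.Adj β w := by
        by_contra hn
        have := h.rr β w hwβ.symm hn
        exact hRcc (by rwa [hβ, hw] at this)
      obtain ⟨-, y, hwy, hy⟩ := key w hw
      have := h.ll _ _ (hG _ _ _ _ hβz.symm hadj hwy)
      exact hRaa (by rwa [hz, hy] at this)
  -- All right vertices are adjacent to that of `v`, so none but it can have the loopless color `b`.
  · have hr : ∀ x, x ≠ v → r x = a ∨ r x = c := by
      intro x hx
      have := hvb x hx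
      rcases hcol (r x) with h1 | h1 | h1
      · exact Or.inl h1
      · exact absurd (h1 ▸ this) hRbb
      · exact Or.inr h1
    by_cases hxa : ∃ x, x ≠ v ∧ r x = a
    · obtain ⟨x, hxv, hx⟩ := hxa
      have hlx : l x = b := ha _ (h.symm _ _ (hx ▸ h.lr x))
      have huniv : ∀ y, y ≠ v → y ≠ x → G.Adj x y := by
        intro y hyv hyx
        by_contra hn
        have h1 : r y = b := ha _ (hx ▸ h.rr x y hyx.symm hn)
        rcases hr y hyv with h2 | h2
        · exact hab (h2.symm.trans h1)
        · exact hbc (h1.symm.trans h2)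
      obtain ⟨y, hxy, -⟩ := (h.liftl x c (hlx ▸ hRbc)).resolve_left
        (fun h' => hac (hx.symm.trans h'))
      rcases hex x hxv huniv y with rfl | rfl
      · exact hv _ hxy.symm
      · exact irr _ hxy
    · have hrc : ∀ x, x ≠ v → r x = c := fun x hx =>
        (hr x hx).resolve_left (fun h' => hxa ⟨x, hx, h'⟩)
      have hna : ∀ x, x ≠ v → l x ≠ a := fun x hx h1 =>
        hRac (h1 ▸ hrc x hx ▸ h.lr x)
      have hnb : ∀ x, x ≠ v → l x ≠ b := by
        intro x hx h1
        obtain ⟨y, hxy, hy⟩ := (h.liftl x a (h1 ▸ hRba)).resolve_left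
          (fun h' => hac (h'.symm.trans (hrc x hx)))
        exact hna y (hvx _ _ hxy.symm) hy
      obtain ⟨x, hx⟩ := h.surj c
      have hxv : x ≠ v := by
        rintro rfl
        rcases hx with hx | hx
        · exact hac (haa.symm.trans hx)
        · exact hbc (hb.symm.trans hx)
      have hlx : l x = c := by
        have := hcol (l x)
        have := hna x hxv
        have := hnb x hxv
        tauto
      obtain ⟨y, hxy, hy⟩ := (h.liftl x b (hlx ▸ hRcb)).resolve_left
        (fun h' => hbc (h'.symm.trans (hrc x hxv)))
      exact hnb y (hvx _ _ hxy.symm) hy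

end Negative

/-! ### Nonexistence for star forests -/

section Stars

variable {V : Type u} {G : SimpleGraph V}

/-- `G` is a disjoint union of stars with at least one edge each, and `c` maps every vertex to the
center of its star. -/
structure StarMap (G : SimpleGraph V) (c : V → V) : Prop where
  adj : ∀ x y, G.Adj x y ↔ x ≠ y ∧ c x = c y ∧ (x = c x ∨ y = c y)
  idem : ∀ x, c (c x) = c x
  exists_adj : ∀ x, ∃ y, G.Adj x y

variable {R : Fin 3 → Fin 3 → Prop} {l r : V → Fin 3} {c : V → V}

theorem StarMap.leaf_adj (hc : StarMap G c) {x : V} (hx : x ≠ c x) (y : V) :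
    G.Adj x y ↔ y = c x := by
  have := hc.idem x
  rw [hc.adj]
  grind

theorem StarMap.center_adj (hc : StarMap G c) {x : V} (hx : c x = x) (y : V) :
    G.Adj x y ↔ y ≠ x ∧ c y = x := by
  rw [hc.adj]
  grind

theorem StarMap.not_adj (hc : StarMap G c) {x y : V} (hx : c x ≠ c y) : ¬ G.Adj x y := by
  rw [hc.adj]
  tauto

theorem StarMap.exists_leaf (hc : StarMap G c) {x : V} (hx : c x = x) :
    ∃ y, y ≠ c y ∧ c y = x ∧ G.Adj x y := by
  obtain ⟨y, hy⟩ := hc.exists_adj x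
  have := (hc.center_adj hx y).1 hy
  exact ⟨y, this.2.symm ▸ this.1, this.2, hy⟩

theorem StarMap.leaf_lift (hc : StarMap G c) (h : PrismRole G R l r) {x : V} (hx : x ≠ c x)
    {i : Fin 3} (hi : R (l x) i) : r x = i ∨ l (c x) = i := by
  rcases h.liftl x i hi with h1 | ⟨y, hy, h1⟩
  · exact Or.inl h1
  · rw [hc.leaf_adj hx] at hy
    exact Or.inr (hy ▸ h1)

theorem StarMap.center_lift (hc : StarMap G c) (h : PrismRole G R l r) {x : V} (hx : c x = x)
    {i : Fin 3} (hi : R (l x) i) : r x = i ∨ ∃ y, y ≠ c y ∧ c y = x ∧ l y = i := by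
  rcases h.liftl x i hi with h1 | ⟨y, hy, h1⟩
  · exact Or.inl h1
  · rw [hc.center_adj hx] at hy
    exact Or.inr ⟨y, by rw [hy.2]; exact hy.1, hy.2, h1⟩

theorem StarMap.center_leaf (hc : StarMap G c) (h : PrismRole G R l r) {x : V} (hx : x ≠ c x) :
    R (l x) (l (c x)) := h.ll _ _ ((hc.leaf_adj hx _).2 rfl)

/-- Two nonadjacent colors cannot occur as the colors of an edge in the right copy. -/
theorem StarMap.right_edge_false (hc : StarMap G c)
    (hout : ∀ v, ∃ u w, u ≠ w ∧ c u ≠ c v ∧ c w ≠ c v ∧ ¬ G.Adj u w) (h : PrismRole G R l r)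
    {i m k : Fin 3} (hik : i ≠ k) (him : i ≠ m) (hmk : m ≠ k) (hRik : ¬ R i k)
    (hRim : R i m) (hRmk : R m k) {y : V} (hy : y ≠ c y) (hri : r (c y) = i) (hrk : r y = k) :
    False := by
  have hcol := fin_three_cases him hik hmk
  have hRki : ¬ R k i := fun h' => hRik (h.symm _ _ h')
  have hmid : ∀ z, c z ≠ c y → r z = m := by
    intro z hz
    have h1 : R i (r z) := by
      rw [← hri]
      refine h.rr _ _ ?_ (hc.not_adj ?_)
      · rintro rfl
        exact hz (hc.idem y)
      · rw [hc.idem]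
        exact hz.symm
    have h2 : R k (r z) := by
      rw [← hrk]
      refine h.rr _ _ ?_ (hc.not_adj hz.symm)
      rintro rfl
      exact hz rfl
    rcases hcol (r z) with h3 | h3 | h3
    · exact absurd (h3 ▸ h2) hRki
    · exact h3
    · exact absurd (h3 ▸ h1) hRik
  have hRmm : R m m := by
    obtain ⟨u, w, huw, hu, hw, hn⟩ := hout y
    have := h.rr u w huw hn
    rwa [hmid u hu, hmid w hw] at this
  -- Color `m` requires neighbors of all three colors, but a left leaf has only two neighbors.
  have leaf_m : ∀ x, x ≠ c x → l x ≠ m := by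
    intro x hx hl
    have h1 := hc.leaf_lift h hx (i := i) (hl ▸ h.symm _ _ hRim)
    have h2 := hc.leaf_lift h hx (i := m) (hl ▸ hRmm)
    have h3 := hc.leaf_lift h hx (i := k) (hl ▸ hRmk)
    grind
  have hly : l y = k := by
    have h1 := h.lr y
    rw [hrk] at h1
    rcases hcol (l y) with h2 | h2 | h2
    · exact absurd (h2 ▸ h1) hRik
    · exact absurd h2 (leaf_m y hy)
    · exact h2
  have hlx : l (c y) = m := by
    have h1 := h.lr (c y)
    have h2 := hc.center_leaf h hy
    rw [hri] at h1
    rw [hly] at h2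
    rcases hcol (l (c y)) with h3 | h3 | h3
    · exact absurd (h3 ▸ h2) hRki
    · exact h3
    · exact absurd (h3 ▸ h1) hRki
  obtain ⟨x, hx, -, hlx'⟩ := (hc.center_lift h (hc.idem y) (i := m) (hlx ▸ hRmm)).resolve_left
    (fun h' => him (hri.symm.trans h'))
  exact leaf_m x hx hlx'

/-- Of two nonadjacent colors, none can be missing in the right copy. -/
theorem StarMap.right_missing_false (hc : StarMap G c)
    (hout : ∀ v, ∃ u, c u ≠ c v) (h : PrismRole G R l r)
    {i m k : Fin 3} (hik : i ≠ k) (him : i ≠ m) (hmk : m ≠ k) (hRik : ¬ R i k)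
    (hRim : R i m) (hRmk : R m k) (hr : ∀ x, r x ≠ k) : False := by
  have hcol := fin_three_cases him hik hmk
  have hRki : ¬ R k i := fun h' => hRik (h.symm _ _ h')
  have hRmi := h.symm _ _ hRim
  have hX : ∀ x, r x = m ↔ l x = k := by
    intro x
    constructor
    · intro hx
      exact (h.liftr x k (hx ▸ hRmk)).resolve_right (by rintro ⟨y, -, -, hy⟩; exact hr y hy)
    · intro hx
      have h1 := h.lr x
      rw [hx] at h1
      rcases hcol (r x) with h2 | h2 | h2
      · exact absurd (h2 ▸ h1) hRki
      · exact h2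
      · exact absurd h2 (hr x)
  have hY : ∀ x, r x = i ↔ l x ≠ k := by
    intro x
    have := hX x
    have := hr x
    have := hcol (r x)
    grind
  have leafY : ∀ x, x ≠ c x → r x = i → l x = m → l (c x) = k ∧ ¬ R m m := by
    intro x hx hri hl
    have h1 := (hc.leaf_lift h hx (i := k) (hl ▸ hRmk)).resolve_left (hr x)
    refine ⟨h1, fun hRmm => ?_⟩
    have h2 := hc.leaf_lift h hx (i := m) (hl ▸ hRmm)
    grind
  have leafY' : ∀ x, x ≠ c x → l x = i → l (c x) = m := by
    intro x hx hl
    exact (hc.leaf_lift h hx (i := m) (hl ▸ hRim)).resolve_left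
      (fun h' => hmk (by rw [hX] at h'; exact absurd (hl.symm.trans h') hik))
  -- Every star meets left color `k`; comparing two stars then yields the loop at `m`, which forces
  -- all left leaves to have color `k`.
  have hstar : ∀ s, c s = s → ∃ x, c x = s ∧ l x = k := by
    intro s hs
    by_contra! hcon
    obtain ⟨y, hy, hys, -⟩ := hc.exists_leaf hs
    have hry := (hY y).2 (hcon y hys)
    rcases hcol (l y) with h1 | h1 | h1
    · have h2 := leafY' y hy h1
      rw [hys] at h2
      obtain ⟨x, -, hx, hx'⟩ := (hc.center_lift h hs (i := k) (h2 ▸ hRmk)).resolve_left (hr s)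
      exact hcon x hx hx'
    · have h2 := (leafY y hy hry h1).1
      rw [hys] at h2
      exact hcon s hs h2
    · exact hcon y hys h1
  obtain ⟨x₀, hx₀⟩ : ∃ x, l x = k := by
    obtain ⟨x, hx⟩ := h.surj k
    exact ⟨x, hx.resolve_right (hr x)⟩
  have hRmm : R m m := by
    obtain ⟨u, hu⟩ := hout x₀
    obtain ⟨x, hxu, hx⟩ := hstar (c u) (hc.idem u)
    have hne : c x ≠ c x₀ := hxu ▸ hu
    have := h.rr x x₀ (fun h' => hne (h' ▸ rfl)) (hc.not_adj hne)
    rwa [(hX x).2 hx, (hX x₀).2 hx₀] at this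
  have noleaf : ∀ x, x ≠ c x → l x = k := by
    intro x hx
    rcases hcol (l x) with h1 | h1 | h1
    · have h2 := leafY' x hx h1
      have h3 : r (c x) = i := (hY _).2 (h2 ▸ hmk)
      obtain ⟨y, hy, -, hy'⟩ := (hc.center_lift h (hc.idem x) (i := m) (h2 ▸ hRmm)).resolve_left
        (fun h' => him (h3.symm.trans h'))
      exact absurd hRmm (leafY y hy ((hY y).2 (hy' ▸ hmk)) hy').2
    · exact absurd hRmm (leafY x hx ((hY x).2 (h1 ▸ hmk)) h1).2
    · exact h1
  obtain ⟨y, -, -, hy⟩ := (h.liftr x₀ i ((hX x₀).2 hx₀ ▸ hRmi)).resolve_left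
    (fun h' => hik (h'.symm.trans hx₀))
  have hly := (hY y).1 hy
  have hcy : c y = y := by
    by_contra hne
    exact hly (noleaf y (Ne.symm hne))
  obtain ⟨x, hx, hxy, -⟩ := hc.exists_leaf hcy
  have hlx := noleaf x hx
  have hRx := hc.center_leaf h hx
  rw [hlx, hxy] at hRx
  rcases hcol (l y) with h1 | h1 | h1
  · exact hRki (h1 ▸ hRx)
  · obtain ⟨z, hz, -, hz'⟩ := (hc.center_lift h hcy (i := m) (h1 ▸ hRmm)).resolve_left
      (fun h' => him (hy.symm.trans h'))
    exact hmk (hz'.symm.trans (noleaf z hz))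
  · exact hly h1

/-- If two colors are nonadjacent, the role graph is a path and the two preceding lemmas apply.
Otherwise a left leaf, its center and its right copy have three distinct colors, and the leaf's
color has no loop. -/
theorem not_prismRole_of_starMap (hc : StarMap G c)
    (hout : ∀ v, ∃ u w, u ≠ w ∧ c u ≠ c v ∧ c w ≠ c v ∧ ¬ G.Adj u w)
    (hind : ∃ f : Fin 4 → V, ∀ i j, i ≠ j → f i ≠ f j ∧ ¬ G.Adj (f i) (f j)) :
    ¬ PrismRole G R l r := by
  intro h
  have hout' : ∀ v, ∃ u, c u ≠ c v := fun v => by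
    obtain ⟨u, -, -, hu, -⟩ := hout v
    exact ⟨u, hu⟩
  by_cases hK : ∀ i j, i ≠ j → R i j
  swap
  · push Not at hK
    obtain ⟨i, k, hik, hRik⟩ := hK
    have hRki : ¬ R k i := fun h' => hRik (h.symm _ _ h')
    obtain ⟨m, him, hmk⟩ : ∃ m : Fin 3, i ≠ m ∧ m ≠ k := by
      clear * - hik
      revert i k
      decide
    have hcol := fin_three_cases him hik hmk
    have hRim : R i m := by
      obtain ⟨j, hj, hj'⟩ := h.exists_adj_ne i
      grind
    have hRkm : R k m := by
      obtain ⟨j, hj, hj'⟩ := h.exists_adj_ne k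
      grind
    have hRmk := h.symm _ _ hRkm
    have hRmi := h.symm _ _ hRim
    by_cases h1 : ∃ x, r x = i
    swap
    · exact hc.right_missing_false hout' h hik.symm hmk.symm him.symm hRki hRkm hRmi
        (fun x hx => h1 ⟨x, hx⟩)
    by_cases h2 : ∃ x, r x = k
    swap
    · exact hc.right_missing_false hout' h hik him hmk hRik hRim hRmk (fun x hx => h2 ⟨x, hx⟩)
    obtain ⟨x, hx⟩ := h1
    obtain ⟨y, hy⟩ := h2
    have hxy : G.Adj x y := by
      by_contra hn
      have := h.rr x y (by rintro rfl; exact hik (hx.symm.trans hy)) hn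
      rw [hx, hy] at this
      exact hRik this
    obtain ⟨hne, hcxy, h3 | h3⟩ := (hc.adj x y).1 hxy
    · exact hc.right_edge_false hout h hik him hmk hRik hRim hRmk (y := y)
        (by rw [← hcxy, ← h3]; exact hne.symm) (by rw [← hcxy, ← h3]; exact hx) hy
    · exact hc.right_edge_false hout h hik.symm hmk.symm him.symm hRki hRkm hRmi (y := x)
        (by rw [hcxy, ← h3]; exact hne) (by rw [hcxy, ← h3]; exact hy) hx
  have leaf : ∀ x, x ≠ c x → ¬ R (l x) (l x) ∧ l x ≠ l (c x) ∧ l x ≠ r x ∧ l (c x) ≠ r x := by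
    intro x hx
    have key : ∀ j, R (l x) j → r x = j ∨ l (c x) = j := fun j hj => hc.leaf_lift h hx hj
    have h1 := hK (l x)
    have h2 := fun j hj => key j (h1 j hj)
    have h3 := hc.center_leaf h hx
    have h4 := h.lr x
    obtain ⟨d, e, hd, he, hde⟩ : ∃ d e, l x ≠ d ∧ l x ≠ e ∧ d ≠ e := by
      generalize l x = q
      revert q
      decide
    have h5 := h2 d hd
    have h6 := h2 e he
    grind
  by_cases hloop : ∃ k, R k k
  swap
  -- Without loops, the right copies of four independent vertices, a clique, need four colors.
  · obtain ⟨f, hf⟩ := hind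
    have hinj : Function.Injective (fun i => r (f i)) := by
      intro i j hij
      by_contra hne
      refine hloop ⟨r (f i), ?_⟩
      have := h.rr _ _ (hf i j hne).1 (hf i j hne).2
      simp only at hij
      rwa [← hij] at this
    have := Fintype.card_le_of_injective _ hinj
    simp at this
  obtain ⟨k, hk⟩ := hloop
  have hleafk : ∀ x, x ≠ c x → l x ≠ k := by
    intro x hx hl
    exact (leaf x hx).1 (hl ▸ hk)
  have hRk : ∀ j, R k j := by
    intro j
    by_cases hj : k = j
    · exact hj ▸ hk
    · exact hK k j hj
  have center_k : ∀ s, c s = s → l s = k → r s = k ∧ ∀ d, d ≠ k → ¬ R d d ∧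
      ∃ x, c x = s ∧ r x = d := by
    intro s hs hl
    have hrs : r s = k := by
      rcases hc.center_lift h hs (i := k) (hl ▸ hk) with h1 | ⟨y, hy, -, hy'⟩
      · exact h1
      · exact absurd hy' (hleafk y hy)
    refine ⟨hrs, fun d hd => ?_⟩
    have hlift : ∀ e, e ≠ k → ∃ y, y ≠ c y ∧ c y = s ∧ l y = e := fun e he =>
      (hc.center_lift h hs (i := e) (hl ▸ hRk e)).resolve_left
        (fun h' => he (h'.symm.trans hrs))
    obtain ⟨y, hy, -, hyd⟩ := hlift d hd
    refine ⟨hyd ▸ (leaf y hy).1, ?_⟩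
    obtain ⟨e, hek, hed⟩ : ∃ e, e ≠ k ∧ e ≠ d := by
      clear * - hd
      revert k d
      decide
    obtain ⟨z, hz, hzs, hze⟩ := hlift e hek
    obtain ⟨-, h1, h2, h3⟩ := leaf z hz
    rw [hzs, hl] at h1 h3
    have := fin_three_cases hek.symm hd.symm hed (r z)
    exact ⟨z, hzs, by grind⟩
  have center_ne : ∀ s, c s = s → l s ≠ k → ∀ x, c x = s → r x = k := by
    intro s hs hl x hxs
    by_cases hx : x = c x
    · have hx : x = s := hx.trans hxs
      subst hx
      rcases hc.center_lift h hs (i := k) (h.symm _ _ (hRk _)) with h1 | ⟨y, hy, -, hy'⟩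
      · exact h1
      · exact absurd hy' (hleafk y hy)
    · obtain ⟨-, h1, h2, h3⟩ := leaf x hx
      have h4 := hleafk x hx
      rw [hxs] at h1 h3
      have := fin_three_cases hl.symm h4.symm h1.symm (r x)
      grind
  -- If no center had left color `k`, all right vertices would have color `k`, and a center would
  -- miss one of the other colors on the right.
  have hs : ∃ s, c s = s ∧ l s = k := by
    obtain ⟨x₀, -⟩ := h.surj k
    by_cases hl : l (c x₀) = k
    · exact ⟨c x₀, hc.idem x₀, hl⟩
    · obtain ⟨e, hek, hed⟩ : ∃ e, e ≠ k ∧ l (c x₀) ≠ e := by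
        generalize l (c x₀) = d at hl
        clear * - hl
        revert k d
        decide
      have hr := center_ne _ (hc.idem x₀) hl _ (hc.idem x₀)
      obtain ⟨z, -, -, hz⟩ := (h.liftr (c x₀) e (hr ▸ hRk e)).resolve_left hed
      refine ⟨c z, hc.idem z, ?_⟩
      by_contra hn
      exact hek (hz ▸ center_ne _ (hc.idem z) hn z rfl)
  obtain ⟨s, hs, hls⟩ := hs
  obtain ⟨hrs, hd⟩ := center_k s hs hls
  obtain ⟨d, hdk⟩ : ∃ d : Fin 3, d ≠ k := exists_ne k
  obtain ⟨hdd, x, hxs, hx⟩ := hd d hdk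
  -- Right color `d` occurs in the star of `s` and, by this lift, in another star, although `d` has
  -- no loop.
  obtain ⟨z, hsz, hz, hzd⟩ := (h.liftr s d (hrs ▸ hRk d)).resolve_left
    (fun h' => hdk (h'.symm.trans hls))
  have hzs : c z ≠ s := by
    intro h1
    exact hz ((hc.center_adj hs z).2 ⟨hsz.symm, h1⟩)
  have hne : c x ≠ c z := hxs ▸ hzs.symm
  have := h.rr x z (fun h' => hne (h' ▸ rfl)) (hc.not_adj hne)
  rw [hx, hzd] at this
  exact hdd this

end Stars

/-! ### Complete bipartite components, and families (1) and (2) -/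

section Isolated

theorem KB_adj {n m : ℕ} (a b : Fin n ⊕ Fin m) : (KB n m).Adj a b ↔ a.isLeft ≠ b.isLeft := by
  rcases a with a | a <;> rcases b with b | b <;> simp

/-- A bijection that preserves and reflects adjacency, as an isomorphism. -/
theorem nonempty_iso_of_bijective {V : Type u} {W : Type v} {G : SimpleGraph V} {H : SimpleGraph W}
    (f : W → V) (hf : Function.Bijective f) (hadj : ∀ a b, G.Adj (f a) (f b) ↔ H.Adj a b) :
    Nonempty (G ≃g H) :=
  ⟨SimpleGraph.Iso.symm ⟨Equiv.ofBijective f hf, fun {a b} => hadj a b⟩⟩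

variable {V : Type u} {G : SimpleGraph V}

theorem walkThreeClosed_of_components
    (h : ∀ C : G.ConnectedComponent, C.supp.Nontrivial →
      ∃ n m : ℕ, 1 ≤ n ∧ 1 ≤ m ∧ Nonempty (C.toSimpleGraph ≃g KB n m)) : WalkThreeClosed G := by
  intro a b c d hab hbc hcd
  obtain ⟨C, hC⟩ : ∃ C, C = G.connectedComponentMk a := ⟨_, rfl⟩
  have ha : a ∈ C := by
    rw [hC]
    exact SimpleGraph.ConnectedComponent.connectedComponentMk_mem
  have hb : b ∈ C := C.mem_supp_of_adj_mem_supp ha hab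
  have hc : c ∈ C := C.mem_supp_of_adj_mem_supp hb hbc
  have hd : d ∈ C := C.mem_supp_of_adj_mem_supp hc hcd
  obtain ⟨n, m, -, -, ⟨e⟩⟩ := h C ⟨a, ha, b, hb, hab.ne⟩
  have hadj : ∀ x y (hx : x ∈ C) (hy : y ∈ C), G.Adj x y ↔
      (e ⟨x, hx⟩).isLeft ≠ (e ⟨y, hy⟩).isLeft := fun x y hx hy => by
    rw [← KB_adj, e.map_adj_iff, C.toSimpleGraph_adj]
  rw [hadj _ _ ha hb] at hab
  rw [hadj _ _ hb hc] at hbc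
  rw [hadj _ _ hc hd] at hcd
  rw [hadj _ _ ha hd]
  generalize (e ⟨a, ha⟩).isLeft = p at *
  generalize (e ⟨b, hb⟩).isLeft = q at *
  generalize (e ⟨c, hc⟩).isLeft = s at *
  generalize (e ⟨d, hd⟩).isLeft = t at *
  revert p q s t
  decide

theorem WalkThreeClosed.not_triangle (h : WalkThreeClosed G) {a b c : V} (hab : G.Adj a b)
    (hbc : G.Adj b c) : ¬ G.Adj a c := fun hac =>
  G.irrefl (h a b c a hab hbc hac.symm)

/-- Each step switches between the neighborhoods of `y` and `x`; these become the two sides of the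
component. -/
theorem WalkThreeClosed.reachable (h : WalkThreeClosed G) {x y w : V} (hxy : G.Adj x y)
    (hw : G.Reachable x w) : G.Adj w y ∨ G.Adj x w := by
  refine reachable_induction (P := fun w => G.Adj w y ∨ G.Adj x w) ?_ hw (Or.inl hxy)
  rintro a b (ha | ha) hab
  · exact Or.inr (h _ _ _ _ hxy ha.symm hab)
  · exact Or.inl (h _ _ _ _ hab.symm ha.symm hxy)

theorem WalkThreeClosed.components [Finite V] (h : WalkThreeClosed G) (C : G.ConnectedComponent)
    (hC : C.supp.Nontrivial) :
    ∃ n m : ℕ, 1 ≤ n ∧ 1 ≤ m ∧ Nonempty (C.toSimpleGraph ≃g KB n m) := by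
  obtain ⟨x, hx, x', hx', hne⟩ := hC
  have hreach : ∀ w, w ∈ C ↔ G.Reachable x w := by
    intro w
    rw [SimpleGraph.ConnectedComponent.mem_supp_iff] at hx
    change w ∈ C.supp ↔ _
    rw [SimpleGraph.ConnectedComponent.mem_supp_iff, ← hx, SimpleGraph.ConnectedComponent.eq]
    exact ⟨fun h => h.symm, fun h => h.symm⟩
  obtain ⟨y, hxy⟩ : ∃ y, G.Adj x y := by
    obtain ⟨p⟩ := (hreach x').1 hx'
    cases p with
    | nil => exact absurd rfl hne
    | cons hadj _ => exact ⟨_, hadj⟩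
  have eP := Finite.equivFin {w // G.Adj w y}
  have eQ := Finite.equivFin {w // G.Adj x w}
  have hPC : ∀ w, G.Adj w y → w ∈ C := fun w hw =>
    (hreach w).2 (hxy.reachable.trans hw.symm.reachable)
  have hQC : ∀ w, G.Adj x w → w ∈ C := fun w hw => (hreach w).2 hw.reachable
  refine ⟨Nat.card {w // G.Adj w y}, Nat.card {w // G.Adj x w},
    Nat.one_le_iff_ne_zero.2 ?_, Nat.one_le_iff_ne_zero.2 ?_, ?_⟩
  · have : Nonempty {w // G.Adj w y} := ⟨⟨x, hxy⟩⟩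
    exact Nat.card_pos.ne'
  · have : Nonempty {w // G.Adj x w} := ⟨⟨y, hxy⟩⟩
    exact Nat.card_pos.ne'
  refine nonempty_iso_of_bijective
    (Sum.elim (fun i => ⟨(eP.symm i).1, hPC _ (eP.symm i).2⟩)
      (fun i => ⟨(eQ.symm i).1, hQC _ (eQ.symm i).2⟩)) ⟨?_, ?_⟩ ?_
  · rintro (i | i) (j | j) hij
    · exact congrArg Sum.inl (eP.symm.injective (Subtype.ext (congrArg (fun z : C => z.1) hij)))
    · exfalso
      simp only [Sum.elim_inl, Sum.elim_inr, Subtype.mk.injEq] at hij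
      have h1 := (eP.symm i).2
      have h2 := (eQ.symm j).2
      rw [hij] at h1
      exact h.not_triangle h2 h1 hxy
    · exfalso
      simp only [Sum.elim_inl, Sum.elim_inr, Subtype.mk.injEq] at hij
      have h1 := (eQ.symm i).2
      have h2 := (eP.symm j).2
      rw [hij] at h1
      exact h.not_triangle h1 h2 hxy
    · exact congrArg Sum.inr (eQ.symm.injective (Subtype.ext (congrArg (fun z : C => z.1) hij)))
  · rintro ⟨w, hw⟩
    rcases h.reachable hxy ((hreach w).1 hw) with h1 | h1
    · exact ⟨Sum.inl (eP ⟨w, h1⟩), by simp⟩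
    · exact ⟨Sum.inr (eQ ⟨w, h1⟩), by simp⟩
  · rintro (i | i) (j | j)
    · have h1 := (eP.symm i).2
      have h2 := (eP.symm j).2
      simp only [Sum.elim_inl, C.toSimpleGraph_adj]
      simpa using fun h' => h.not_triangle h' h2 h1
    · have h1 := (eP.symm i).2
      have h2 := (eQ.symm j).2
      simp only [Sum.elim_inl, Sum.elim_inr, C.toSimpleGraph_adj]
      simpa using h _ _ _ _ h1 hxy.symm h2
    · have h1 := (eQ.symm i).2
      have h2 := (eP.symm j).2
      simp only [Sum.elim_inl, Sum.elim_inr, C.toSimpleGraph_adj]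
      simpa using h _ _ _ _ h1.symm hxy h2.symm
    · have h1 := (eQ.symm i).2
      have h2 := (eQ.symm j).2
      simp only [Sum.elim_inr, C.toSimpleGraph_adj]
      simpa using fun h' => h.not_triangle h1 h' h2

theorem nonempty_iso_isolated_star [Finite V] (h : WalkThreeClosed G) {v x y : V}
    (hv : ∀ w, ¬ G.Adj v w) (hxv : x ≠ v) (hx : ∀ w, w ≠ v → w ≠ x → G.Adj x w)
    (hyv : y ≠ v) (hyx : y ≠ x) :
    ∃ m : ℕ, 1 ≤ m ∧ Nonempty (G ≃g (K 1 ⊕g KB 1 m)) := by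
  have e := Finite.equivFin {w // w ≠ v ∧ w ≠ x}
  refine ⟨Nat.card {w // w ≠ v ∧ w ≠ x}, Nat.one_le_iff_ne_zero.2 ?_, ?_⟩
  · have : Nonempty {w // w ≠ v ∧ w ≠ x} := ⟨⟨y, hyv, hyx⟩⟩
    exact Nat.card_pos.ne'
  have hv' : ∀ w, ¬ G.Adj w v := fun w hw => hv w hw.symm
  refine nonempty_iso_of_bijective
    (Sum.elim (fun _ => v) (Sum.elim (fun _ => x) (fun i => (e.symm i).1))) ⟨?_, ?_⟩ ?_
  · rintro (i | i | i) (j | j | j) hij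
    · simp [Subsingleton.elim i j]
    · exact absurd hij.symm hxv
    · exact absurd hij.symm (e.symm j).2.1
    · exact absurd hij hxv
    · simp [Subsingleton.elim i j]
    · exact absurd hij.symm (e.symm j).2.2
    · exact absurd hij (e.symm i).2.1
    · exact absurd hij (e.symm i).2.2
    · exact congrArg (Sum.inr ∘ Sum.inr) (e.symm.injective (Subtype.ext hij))
  · intro w
    by_cases h1 : w = v
    · exact ⟨Sum.inl 0, h1.symm⟩
    by_cases h2 : w = x
    · exact ⟨Sum.inr (Sum.inl 0), h2.symm⟩
    · exact ⟨Sum.inr (Sum.inr (e ⟨w, h1, h2⟩)), by simp⟩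
  · rintro (i | i | i) (j | j | j)
    · simp [Subsingleton.elim i j]
    · simpa using hv x
    · simpa using hv _
    · simpa using hv' x
    · simp
    · simpa using hx _ (e.symm j).2.1 (e.symm j).2.2
    · simpa using hv' _
    · simpa using (hx _ (e.symm i).2.1 (e.symm i).2.2).symm
    · have h1 := hx _ (e.symm i).2.1 (e.symm i).2.2
      have h2 := hx _ (e.symm j).2.1 (e.symm j).2.2
      simpa using fun h' => h.not_triangle h1 h' h2

theorem prism_role_of_iso_isolated_star {m : ℕ} (hm : 1 ≤ m) (e : G ≃g (K 1 ⊕g KB 1 m)) :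
    HasRoleAssignment (prism G) 3 := by
  refine hasRoleAssignment_iso (prismCongr G e) ?_
  refine prism_role_of_isolated_universal (v := Sum.inl 0) (y := Sum.inr (Sum.inl 0))
    (c := Sum.inr (Sum.inr ⟨0, hm⟩)) ?_ (by simp) ?_ (by simp)
  · rintro (i | i | i)
    · simp [Subsingleton.elim i 0]
    · simp
    · simp
  · rintro (i | i | i)
    · simp [Subsingleton.elim i 0]
    · simp [Subsingleton.elim i 0]
    · simp

theorem not_prism_role_of_isolatedFamily [Finite V] (h : IsIsolatedFamily G) :
    ¬ HasRoleAssignment (prism G) 3 := by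
  obtain ⟨⟨v, hv⟩, hcomp, hne⟩ := h
  have hG := walkThreeClosed_of_components hcomp
  intro hrole
  obtain ⟨R, l, r, hR⟩ := exists_prismRole hrole
  refine not_prismRole_of_isolated hG hv ?_ hR
  intro x hxv hx y
  by_contra! hy
  exact hne (nonempty_iso_isolated_star hG hv hxv hx hy.1 hy.2)

theorem not_prism_role_of_completeFamily (h : IsCompleteFamily G) :
    ¬ HasRoleAssignment (prism G) 3 := by
  obtain ⟨n, hn, ⟨e⟩⟩ := h
  have hadj : ∀ x y, ¬ Gᶜ.Adj x y := by
    intro x y hxy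
    rw [SimpleGraph.compl_adj, ← e.map_adj_iff] at hxy
    exact hxy.2 (by simpa using hxy.1)
  intro hrole
  rw [← compl_compl G] at hrole
  obtain ⟨R, l, r, hR⟩ := exists_prismRole (prism_compl_role Gᶜ hrole)
  refine not_prismRole_of_isolated (v := e.symm ⟨0, by omega⟩) ?_ (hadj _) ?_ hR
  · intro a b c d hab
    exact absurd hab (hadj _ _)
  · intro x hxv hx y
    by_contra! hy
    exact hadj _ _ (hx y hy.1 hy.2)

/-- Color a vertex by whether it is adjacent to a chosen representative of its component. -/
theorem WalkThreeClosed.isBipartite (h : WalkThreeClosed G) : G.IsBipartite := by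
  classical
  let rep : V → V := fun w => (G.connectedComponentMk w).out
  have hrep : ∀ w, G.Reachable (rep w) w := fun w =>
    SimpleGraph.ConnectedComponent.exact (G.connectedComponentMk w).out_eq
  have hrep' : ∀ a b, G.Adj a b → rep a = rep b := fun a b hab => by
    simp only [rep, SimpleGraph.ConnectedComponent.sound hab.reachable]
  refine ⟨SimpleGraph.Coloring.mk (fun w => if G.Adj (rep w) w then (1 : Fin 2) else 0) ?_⟩
  intro a b hab
  have hr := hrep' a b hab
  by_cases ha : G.Adj (rep a) a
  · have hb : ¬ G.Adj (rep b) b := by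
      rw [← hr]
      exact h.not_triangle ha hab
    simp [ha, hb]
  · have hb : G.Adj (rep b) b := by
      rw [← hr]
      by_cases hra : rep a = a
      · rw [hra]
        exact hab
      · obtain ⟨c, t, hc, -, -, -⟩ := exists_adj_adj_of_reachable (hrep a) (Ne.symm hra) ha
        rcases h.reachable hc (hrep a) with h1 | h1
        · exact h _ _ _ _ hc h1.symm hab
        · exact absurd h1 ha
    simp [ha, hb]

end Isolated

/-! ### Star forests: families (3) to (5) and the small exceptions -/

section StarForest

/-- The disjoint union of the stars `K_{1,m_i}`. -/
abbrev starForest {t : ℕ} (m : Fin t → ℕ) : SimpleGraph (Σ i : Fin t, Fin 1 ⊕ Fin (m i)) :=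
  disjointUnion (fun i => KB 1 (m i))

theorem starForest_adj {t : ℕ} {m : Fin t → ℕ} (x y : Σ i : Fin t, Fin 1 ⊕ Fin (m i)) :
    (starForest m).Adj x y ↔ x.1 = y.1 ∧ x.2.isLeft ≠ y.2.isLeft := by
  constructor
  · rintro ⟨i, a, b, h, rfl, rfl⟩
    exact ⟨rfl, (KB_adj a b).1 h⟩
  · rcases x with ⟨i, a⟩
    rcases y with ⟨j, b⟩
    rintro ⟨h, h'⟩
    obtain rfl : i = j := h
    exact ⟨i, a, b, (KB_adj a b).2 h', rfl, rfl⟩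

theorem starMap_starForest {t : ℕ} {m : Fin t → ℕ} (hm : ∀ i, 1 ≤ m i) :
    StarMap (starForest m) (fun x => ⟨x.1, Sum.inl 0⟩) where
  adj := by
    rintro ⟨i, a | a⟩ ⟨j, b | b⟩ <;> rw [starForest_adj]
    · simp only [Sum.isLeft_inl, ne_eq, not_true_eq_false, and_false, false_iff, not_and]
      intro h1 h2
      obtain rfl : i = j := congrArg Sigma.fst h2
      exact absurd (by rw [Subsingleton.elim a b]) h1
    · simp only [Sum.isLeft_inl, Sum.isLeft_inr]
      constructor
      · rintro ⟨rfl, -⟩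
        exact ⟨by simp, rfl, Or.inl (by rw [Subsingleton.elim a 0])⟩
      · rintro ⟨-, h, -⟩
        exact ⟨congrArg Sigma.fst h, by simp⟩
    · simp only [Sum.isLeft_inl, Sum.isLeft_inr]
      constructor
      · rintro ⟨rfl, -⟩
        exact ⟨by simp, rfl, Or.inr (by rw [Subsingleton.elim b 0])⟩
      · rintro ⟨-, h, -⟩
        exact ⟨congrArg Sigma.fst h, by simp⟩
    · simp
  idem := fun _ => rfl
  exists_adj := by
    rintro ⟨i, a | a⟩
    · exact ⟨⟨i, Sum.inr ⟨0, hm i⟩⟩, by simp [starForest_adj]⟩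
    · exact ⟨⟨i, Sum.inl 0⟩, by simp [starForest_adj]⟩

/-- The star forests without `3`-role assignment. -/
def StarCondition {t : ℕ} (m : Fin t → ℕ) : Prop :=
  4 ≤ t ∨ (3 ≤ t ∧ ∃ i, 2 ≤ m i) ∨ (t = 2 ∧ ∀ i, 2 ≤ m i)

theorem StarCondition.two_le {t : ℕ} {m : Fin t → ℕ} (h : StarCondition m) : 2 ≤ t := by
  rcases h with h | ⟨h, -⟩ | ⟨h, -⟩ <;> omega

theorem exists_ne_of_two_le {t : ℕ} (ht : 2 ≤ t) (i : Fin t) : ∃ j, j ≠ i := by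
  have : Nontrivial (Fin t) := Fin.nontrivial_iff_two_le.2 ht
  exact exists_ne i

theorem exists_ne_ne_of_three_le {t : ℕ} (ht : 3 ≤ t) (i : Fin t) :
    ∃ j k, j ≠ i ∧ k ≠ i ∧ j ≠ k := by
  obtain ⟨j, hj, k, hk, hjk⟩ := Finset.one_lt_card.1
    (show 1 < (Finset.univ.erase i).card by
      rw [Finset.card_erase_of_mem (Finset.mem_univ i), Finset.card_univ, Fintype.card_fin]
      omega)
  exact ⟨j, k, Finset.ne_of_mem_erase hj, Finset.ne_of_mem_erase hk, hjk⟩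

/-- Two centers of other stars if there are three stars; otherwise two leaves of the other star. -/
theorem StarCondition.exists_outside {t : ℕ} {m : Fin t → ℕ} (h : StarCondition m) (i : Fin t) :
    ∃ u w : Σ i : Fin t, Fin 1 ⊕ Fin (m i),
      u ≠ w ∧ u.1 ≠ i ∧ w.1 ≠ i ∧ ¬ (starForest m).Adj u w := by
  by_cases ht : 3 ≤ t
  · obtain ⟨j, k, hj, hk, hjk⟩ := exists_ne_ne_of_three_le ht i
    exact ⟨⟨j, Sum.inl 0⟩, ⟨k, Sum.inl 0⟩, fun h' => hjk (congrArg Sigma.fst h'), hj, hk,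
      by simp [starForest_adj]⟩
  · have hm : ∀ i, 2 ≤ m i := by
      rcases h with h | ⟨h, -⟩ | ⟨-, h⟩
      · omega
      · omega
      · exact h
    obtain ⟨j, hj⟩ := exists_ne_of_two_le h.two_le i
    exact ⟨⟨j, Sum.inr ⟨0, by have := hm j; omega⟩⟩, ⟨j, Sum.inr ⟨1, by have := hm j; omega⟩⟩,
      by simp, hj, hj, by simp [starForest_adj]⟩

theorem exists_independent_four {V : Type u} {G : SimpleGraph V} {a b c d : V}
    (hab : a ≠ b ∧ ¬ G.Adj a b) (hac : a ≠ c ∧ ¬ G.Adj a c) (had : a ≠ d ∧ ¬ G.Adj a d)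
    (hbc : b ≠ c ∧ ¬ G.Adj b c) (hbd : b ≠ d ∧ ¬ G.Adj b d) (hcd : c ≠ d ∧ ¬ G.Adj c d) :
    ∃ f : Fin 4 → V, ∀ i j, i ≠ j → f i ≠ f j ∧ ¬ G.Adj (f i) (f j) := by
  have sym : ∀ a b, a ≠ b ∧ ¬ G.Adj a b → b ≠ a ∧ ¬ G.Adj b a := fun a b h =>
    ⟨h.1.symm, fun h' => h.2 h'.symm⟩
  refine ⟨![a, b, c, d], fun i j hij => ?_⟩
  fin_cases i <;> fin_cases j <;> first | exact absurd rfl hij | assumption | (apply sym; assumption)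

theorem StarCondition.exists_independent {t : ℕ} {m : Fin t → ℕ} (h : StarCondition m) :
    ∃ f : Fin 4 → Σ i : Fin t, Fin 1 ⊕ Fin (m i),
      ∀ i j, i ≠ j → f i ≠ f j ∧ ¬ (starForest m).Adj (f i) (f j) := by
  have far : ∀ x y : Σ i : Fin t, Fin 1 ⊕ Fin (m i), x.1 ≠ y.1 →
      x ≠ y ∧ ¬ (starForest m).Adj x y := fun x y hxy =>
    ⟨fun h => hxy (congrArg Sigma.fst h), fun h => hxy ((starForest_adj x y).1 h).1⟩
  have near : ∀ i (h : 2 ≤ m i),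
      (⟨i, Sum.inr ⟨0, by omega⟩⟩ : Σ i : Fin t, Fin 1 ⊕ Fin (m i)) ≠ ⟨i, Sum.inr ⟨1, h⟩⟩ ∧
      ¬ (starForest m).Adj ⟨i, Sum.inr ⟨0, by omega⟩⟩ ⟨i, Sum.inr ⟨1, h⟩⟩ := fun i h =>
    ⟨by simp, by simp [starForest_adj]⟩
  rcases h with h | ⟨h, i, hi⟩ | ⟨h, hm⟩
  · refine ⟨fun i => ⟨Fin.castLE h i, Sum.inl 0⟩, fun i j hij => far _ _ ?_⟩
    simpa using hij
  · obtain ⟨j, k, hj, hk, hjk⟩ := exists_ne_ne_of_three_le h i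
    exact exists_independent_four (near i hi) (far _ ⟨j, Sum.inl 0⟩ hj.symm)
      (far _ ⟨k, Sum.inl 0⟩ hk.symm) (far _ _ hj.symm) (far _ _ hk.symm) (far _ _ hjk)
  · have i : Fin t := ⟨0, by omega⟩
    obtain ⟨j, hj⟩ := exists_ne_of_two_le h.ge i
    exact exists_independent_four (near i (hm i)) (far _ _ hj.symm) (far _ _ hj.symm)
      (far _ _ hj.symm) (far _ _ hj.symm) (near j (hm j))

theorem not_prism_role_of_starForest {t : ℕ} {m : Fin t → ℕ} (hm : ∀ i, 1 ≤ m i)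
    (h : StarCondition m) : ¬ HasRoleAssignment (prism (starForest m)) 3 := by
  intro hrole
  obtain ⟨R, l, r, hR⟩ := exists_prismRole hrole
  refine not_prismRole_of_starMap (starMap_starForest hm) ?_ h.exists_independent hR
  intro v
  obtain ⟨a, b, h1, h2, h3, h4⟩ := h.exists_outside v.1
  exact ⟨a, b, h1, fun h' => h2 (congrArg Sigma.fst h' :),
    fun h' => h3 (congrArg Sigma.fst h' :), h4⟩

/-- Componentwise isomorphic families have isomorphic disjoint unions. -/
theorem nonempty_disjointUnion_iso {ι : Type} {α β : ι → Type} {H : (i : ι) → SimpleGraph (α i)}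
    {H' : (i : ι) → SimpleGraph (β i)} (e : (i : ι) → H i ≃g H' i) :
    Nonempty (disjointUnion H ≃g disjointUnion H') := by
  refine ⟨⟨Equiv.sigmaCongrRight fun i => (e i).toEquiv, ?_⟩⟩
  rintro ⟨i, a⟩ ⟨j, b⟩
  constructor
  · rintro ⟨k, a', b', h, h1, h2⟩
    obtain rfl : i = k := congrArg Sigma.fst h1
    obtain rfl : j = i := congrArg Sigma.fst h2
    obtain rfl : e j a = a' := eq_of_heq (Sigma.mk.inj h1).2
    obtain rfl : e j b = b' := eq_of_heq (Sigma.mk.inj h2).2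
    exact ⟨j, a, b, (e j).map_adj_iff.1 h, rfl, rfl⟩
  · rintro ⟨k, a', b', h, h1, h2⟩
    obtain rfl : i = k := congrArg Sigma.fst h1
    obtain rfl : j = i := congrArg Sigma.fst h2
    obtain rfl : a = a' := eq_of_heq (Sigma.mk.inj h1).2
    obtain rfl : b = b' := eq_of_heq (Sigma.mk.inj h2).2
    exact ⟨j, e j a, e j b, (e j).map_adj_iff.2 h, rfl, rfl⟩

theorem nonempty_matching_iso (t : ℕ) :
    Nonempty (disjointUnion (fun _ : Fin t => K 2) ≃g starForest (fun _ : Fin t => 1)) := by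
  refine nonempty_disjointUnion_iso fun _ => SimpleGraph.Iso.symm ⟨finSumFinEquiv, ?_⟩
  rintro (a | a) (b | b) <;> simp [Subsingleton.elim a 0, Subsingleton.elim b 0]

theorem nonempty_two_stars_iso (m : Fin 2 → ℕ) :
    Nonempty ((KB 1 (m 0) ⊕g KB 1 (m 1)) ≃g starForest m) := by
  suffices h : Nonempty (starForest m ≃g (KB 1 (m 0) ⊕g KB 1 (m 1))) by
    obtain ⟨e⟩ := h
    exact ⟨e.symm⟩
  refine nonempty_iso_of_bijective (Sum.elim (fun a => ⟨0, a⟩) (fun a => ⟨1, a⟩)) ⟨?_, ?_⟩ ?_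
  · rintro (a | a) (b | b) h
    · simpa using h
    · exact absurd (congrArg Sigma.fst h) (by simp)
    · exact absurd (congrArg Sigma.fst h) (by simp)
    · simpa using h
  · rintro ⟨i, a⟩
    fin_cases i
    · exact ⟨Sum.inl a, rfl⟩
    · exact ⟨Sum.inr a, rfl⟩
  · rintro (a | a) (b | b) <;> rw [starForest_adj]
    · rw [SimpleGraph.sum_adj_inl, KB_adj]
      simp
    · simp
    · simp
    · rw [SimpleGraph.sum_adj_inr, KB_adj]
      simp

variable {V : Type u} {G : SimpleGraph V}

theorem starCondition_iff : (IsMatchingFamily G ∨ IsManyStarsFamily G ∨ IsTwoStarsFamily G) ↔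
    ∃ (t : ℕ) (m : Fin t → ℕ), (∀ i, 1 ≤ m i) ∧ StarCondition m ∧
      Nonempty (G ≃g starForest m) := by
  constructor
  · rintro (⟨t, ht, ⟨e⟩⟩ | ⟨t, m, ht, hm, hm', he⟩ | ⟨m₁, m₂, h₁, h₂, ⟨e⟩⟩)
    · obtain ⟨e'⟩ := nonempty_matching_iso t
      exact ⟨t, fun _ => 1, fun _ => le_rfl, Or.inl ht, ⟨e.trans e'⟩⟩
    · exact ⟨t, m, hm, Or.inr (Or.inl ⟨ht, hm'⟩), he⟩
    · obtain ⟨e'⟩ := nonempty_two_stars_iso ![m₁, m₂]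
      have hm : ∀ i, 2 ≤ ![m₁, m₂] i := by
        intro i
        fin_cases i <;> assumption
      exact ⟨2, ![m₁, m₂], fun i => by have := hm i; omega, Or.inr (Or.inr ⟨rfl, hm⟩),
        ⟨e.trans e'⟩⟩
  · rintro ⟨t, m, hm, h, ⟨e⟩⟩
    by_cases hm2 : ∃ i, 2 ≤ m i
    · by_cases ht : 3 ≤ t
      · exact Or.inr (Or.inl ⟨t, m, ht, hm, hm2, ⟨e⟩⟩)
      · rcases h with h | ⟨h, -⟩ | ⟨rfl, h⟩
        · omega
        · omega
        · obtain ⟨e'⟩ := nonempty_two_stars_iso m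
          exact Or.inr (Or.inr ⟨m 0, m 1, h 0, h 1, ⟨e.trans e'.symm⟩⟩)
    · have hm1 : m = fun _ => 1 := by
        funext i
        have := hm i
        by_contra hne
        exact hm2 ⟨i, by omega⟩
      subst hm1
      obtain ⟨e'⟩ := nonempty_matching_iso t
      refine Or.inl ⟨t, ?_, ⟨e.trans e'.symm⟩⟩
      rcases h with h | ⟨h, i, hi⟩ | ⟨rfl, h⟩
      · exact h
      · exact absurd hi (by norm_num)
      · exact absurd (h 0) (by norm_num)

theorem starForest_isBipartite {t : ℕ} (m : Fin t → ℕ) : (starForest m).IsBipartite := by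
  refine ⟨SimpleGraph.Coloring.mk (fun x => if x.2.isLeft then (1 : Fin 2) else 0) ?_⟩
  intro a b hab
  have := ((starForest_adj a b).1 hab).2
  generalize a.2.isLeft = p at *
  generalize b.2.isLeft = q at *
  revert p q
  decide

theorem not_connected_of_iso_starForest {t : ℕ} {m : Fin t → ℕ} (ht : 2 ≤ t)
    (e : G ≃g starForest m) : ¬ G.Connected := by
  intro h
  let x : Σ i : Fin t, Fin 1 ⊕ Fin (m i) := ⟨⟨0, by omega⟩, Sum.inl 0⟩
  let y : Σ i : Fin t, Fin 1 ⊕ Fin (m i) := ⟨⟨1, by omega⟩, Sum.inl 0⟩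
  have := reachable_induction (P := fun w => (e w).1 = x.1) ?_
    (h.preconnected (e.symm x) (e.symm y)) (by simp)
  · simp [x, y] at this
  · intro a b ha hab
    rw [← e.map_adj_iff, starForest_adj] at hab
    exact hab.1 ▸ ha

/-- A vertex whose component is a star centered at it. -/
def IsStarCenter (G : SimpleGraph V) (s : V) : Prop := ∀ a b, G.Adj s a → G.Adj a b → b = s

theorem IsStarCenter.eq_or_adj {s w : V} (hs : IsStarCenter G s) (hw : G.Reachable s w) :
    w = s ∨ G.Adj s w := by
  refine reachable_induction (P := fun w => w = s ∨ G.Adj s w) ?_ hw (Or.inl rfl)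
  rintro a b (rfl | ha) hab
  · exact Or.inr hab
  · exact Or.inl (hs a b ha hab)

/-- If a neighbor `u` of `x` is not a center, a path `u`, `a`, `b` leaves it, and then `a` is one.
-/
theorem exists_isStarCenter (hiso : ∀ w, ∃ w', G.Adj w w')
    (h : ∀ a b c d, G.Adj a b → G.Adj b c → G.Adj c d → a = c ∨ b = d) (x : V) :
    ∃ s, IsStarCenter G s ∧ G.Reachable x s := by
  obtain ⟨u, hxu⟩ := hiso x
  by_cases hu : IsStarCenter G u
  · exact ⟨u, hu, hxu.reachable⟩
  · unfold IsStarCenter at hu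
    push Not at hu
    obtain ⟨a, b, hua, hab, hbu⟩ := hu
    refine ⟨a, fun p q hap hpq => ?_, hxu.reachable.trans hua.reachable⟩
    have h1 := h q p a u hpq.symm hap.symm hua.symm
    have h2 := h q p a b hpq.symm hap.symm hab
    grind

theorem nonempty_iso_starForest [Finite V] (hiso : ∀ w, ∃ w', G.Adj w w')
    (h : ∀ a b c d, G.Adj a b → G.Adj b c → G.Adj c d → a = c ∨ b = d) :
    ∃ (t : ℕ) (m : Fin t → ℕ), (∀ i, 1 ≤ m i) ∧ Nonempty (G ≃g starForest m) := by
  have eC := Finite.equivFin G.ConnectedComponent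
  have hs : ∀ i, ∃ s, IsStarCenter G s ∧ G.connectedComponentMk s = eC.symm i := by
    intro i
    obtain ⟨x, hx⟩ := (eC.symm i).exists_rep
    obtain ⟨s, hs, hxs⟩ := exists_isStarCenter hiso h x
    exact ⟨s, hs, (SimpleGraph.ConnectedComponent.sound hxs.symm).trans hx⟩
  choose s hs hsC using hs
  have e : ∀ i, {w // G.Adj (s i) w} ≃ Fin (Nat.card {w // G.Adj (s i) w}) := fun i =>
    Finite.equivFin _
  let f : (Σ i, Fin 1 ⊕ Fin (Nat.card {w // G.Adj (s i) w})) → V := fun x =>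
    Sum.elim (fun _ => s x.1) (fun j => ((e x.1).symm j).1) x.2
  have hf : ∀ x, G.Reachable (s x.1) (f x) := by
    rintro ⟨i, a | a⟩
    · exact SimpleGraph.Reachable.refl _
    · exact ((e i).symm a).2.reachable
  have hfst : ∀ x y, G.Reachable (f x) (f y) → x.1 = y.1 := by
    intro x y hxy
    have := SimpleGraph.ConnectedComponent.sound ((hf x).trans (hxy.trans (hf y).symm))
    rw [hsC, hsC] at this
    exact eC.symm.injective this
  refine ⟨Nat.card G.ConnectedComponent, fun i => Nat.card {w // G.Adj (s i) w}, ?_, ?_⟩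
  · intro i
    obtain ⟨w, hw⟩ := hiso (s i)
    have : Nonempty {w // G.Adj (s i) w} := ⟨⟨w, hw⟩⟩
    exact Nat.card_pos
  refine nonempty_iso_of_bijective f ⟨?_, ?_⟩ ?_
  · intro x y hxy
    have h1 := hfst x y (hxy ▸ SimpleGraph.Reachable.refl _)
    rcases x with ⟨i, a⟩
    rcases y with ⟨j, b⟩
    obtain rfl : i = j := h1
    rcases a with a | a <;> rcases b with b | b
    · rw [Subsingleton.elim a b]
    · exact absurd hxy ((e i).symm b).2.ne
    · exact absurd hxy.symm ((e i).symm a).2.ne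
    · rw [(e i).symm.injective (Subtype.ext hxy)]
  · intro w
    obtain ⟨i, hi⟩ := eC.symm.surjective (G.connectedComponentMk w)
    have hw : G.Reachable (s i) w :=
      SimpleGraph.ConnectedComponent.exact ((hsC i).trans hi)
    rcases (hs i).eq_or_adj hw with rfl | h1
    · exact ⟨⟨i, Sum.inl 0⟩, rfl⟩
    · exact ⟨⟨i, Sum.inr (e i ⟨w, h1⟩)⟩, by simp [f]⟩
  · intro x y
    rw [starForest_adj]
    constructor
    · intro hxy
      have h1 := hfst x y hxy.reachable
      refine ⟨h1, ?_⟩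
      rcases x with ⟨i, a⟩
      rcases y with ⟨j, b⟩
      obtain rfl : i = j := h1
      rcases a with a | a <;> rcases b with b | b
      · exact absurd hxy G.irrefl
      · simp
      · simp
      · have h2 := hs i _ _ ((e i).symm a).2 hxy
        exact absurd h2 ((e i).symm b).2.ne.symm
    · rcases x with ⟨i, a⟩
      rcases y with ⟨j, b⟩
      rintro ⟨h1, h2⟩
      obtain rfl : i = j := h1
      rcases a with a | a <;> rcases b with b | b
      · simp at h2
      · exact ((e i).symm b).2
      · exact ((e i).symm a).2.symm
      · simp at h2

/-- Apart from itself, the center of star `j` has as nonneighbors just the two vertices of the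
`K_2`, which form a clique. -/
theorem prism_role_of_starForest_two {m : Fin 2 → ℕ} (hm : ∀ i, 1 ≤ m i) {i : Fin 2}
    (hi : m i = 1) : HasRoleAssignment (prism (starForest m)) 3 := by
  obtain ⟨j, hj⟩ : ∃ j : Fin 2, j ≠ i := exists_ne i
  have hij : ∀ k, k ≠ j → k = i := by omega
  refine prism_role_of_compl_single (x := ⟨j, Sum.inl 0⟩)
    ⟨⟨i, Sum.inl 0⟩, ?_, ?_⟩ ?_ ?_ ⟨⟨j, Sum.inr ⟨0, hm j⟩⟩, ?_⟩ ?_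
  · exact fun h => hj (congrArg Sigma.fst h).symm
  · simp [starForest_adj, hj]
  · have key : ∀ a : Σ i : Fin 2, Fin 1 ⊕ Fin (m i), a ≠ ⟨j, Sum.inl 0⟩ →
        ¬ (starForest m).Adj ⟨j, Sum.inl 0⟩ a → a.1 = i := by
      rintro ⟨k, a⟩ h1 h2
      apply hij
      rintro rfl
      rcases a with a | a
      · exact h1 (by rw [Subsingleton.elim a 0])
      · exact h2 (by simp [starForest_adj])
    intro a b ha hb ha' hb' hab
    have h1 := key a ha ha'
    have h2 := key b hb hb'
    rcases a with ⟨k, a⟩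
    rcases b with ⟨k', b⟩
    obtain rfl : k = i := h1
    obtain rfl : k' = k := h2
    rw [starForest_adj]
    refine ⟨rfl, fun h3 => hab ?_⟩
    rcases a with a | a <;> rcases b with b | b
    · rw [Subsingleton.elim a b]
    · simp at h3
    · simp at h3
    · have : a = b := by
        apply Fin.ext
        omega
      rw [this]
  · intro w hw
    have h1 := ((starForest_adj _ _).1 hw).1
    refine ⟨⟨i, Sum.inl 0⟩, fun h => hj (congrArg Sigma.fst h).symm, ?_, ?_⟩
    · simp [starForest_adj, hj]
    · rw [starForest_adj]
      exact fun h => hj (h1.trans h.1.symm)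
  · simp [starForest_adj]
  · intro a ha ha'
    obtain ⟨b, hb⟩ := (starMap_starForest hm).exists_adj a
    refine ⟨b, ?_, hb⟩
    rintro rfl
    exact ha' hb.symm

theorem prism_role_of_starForest_three :
    HasRoleAssignment (prism (starForest (fun _ : Fin 3 => 1))) 3 := by
  -- The `i`-th edge has color `i` on the right and, modulo 3, the two other colors on the left; the
  -- role graph is the loopless triangle.
  let p : (Σ _ : Fin 3, Fin 1 ⊕ Fin 1) ⊕ (Σ _ : Fin 3, Fin 1 ⊕ Fin 1) → Fin 3 :=
    Sum.elim (fun x => if x.2.isLeft then x.1 + 1 else x.1 + 2) (fun x => x.1)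
  refine hasRoleAssignment_of_map _ ⟨fun i j => i ≠ j, fun _ _ h => h.symm⟩ p ?_ ?_ ?_
  · exact fun i => ⟨Sum.inr ⟨i, Sum.inl 0⟩, rfl⟩
  · rintro (⟨i, a⟩ | ⟨i, a⟩) (⟨j, b⟩ | ⟨j, b⟩) h
    · rw [prism_adj_inl_inl, starForest_adj] at h
      obtain ⟨rfl, h⟩ : i = j ∧ a.isLeft ≠ b.isLeft := h
      change (if a.isLeft then i + 1 else i + 2) ≠ (if b.isLeft then i + 1 else i + 2)
      revert h
      generalize a.isLeft = x
      generalize b.isLeft = y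
      revert i x y
      decide
    · obtain rfl : i = j := congrArg Sigma.fst h
      change (if a.isLeft then i + 1 else i + 2) ≠ i
      generalize a.isLeft = x
      clear * -
      revert i x
      decide
    · obtain rfl : i = j := congrArg Sigma.fst h
      change i ≠ (if b.isLeft then i + 1 else i + 2)
      generalize b.isLeft = x
      clear * -
      revert i x
      decide
    · rw [prism_adj_inr_inr, starForest_adj] at h
      intro hij
      obtain rfl : i = j := hij
      rcases a with a | a <;> rcases b with b | b <;>
        simp [Subsingleton.elim a b] at h
  · rintro (⟨i, a⟩ | ⟨i, a⟩) c h
    · by_cases hc : c = i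
      · exact ⟨Sum.inr ⟨i, a⟩, rfl, hc.symm⟩
      · refine ⟨Sum.inl ⟨i, a.swap⟩, ?_, ?_⟩
        · rw [prism_adj_inl_inl, starForest_adj]
          rcases a with a | a <;> simp
        · change (if a.swap.isLeft then i + 1 else i + 2) = c
          replace h : (if a.isLeft then i + 1 else i + 2) ≠ c := h
          rcases a with a | a <;> simp at h ⊢ <;> clear * - h hc <;> revert i c <;> decide
    · refine ⟨Sum.inr ⟨c, Sum.inl 0⟩, ?_, rfl⟩
      rw [prism_adj_inr_inr, starForest_adj]
      exact ⟨fun h' => h (congrArg Sigma.fst h'), fun h' => h h'.1⟩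

/-! ### Assembly of the classification -/

theorem isExceptional_iff : IsExceptional G ↔ IsCompleteFamily G ∨ IsIsolatedFamily G ∨
    ∃ (t : ℕ) (m : Fin t → ℕ), (∀ i, 1 ≤ m i) ∧ StarCondition m ∧
      Nonempty (G ≃g starForest m) := by
  rw [← starCondition_iff, IsExceptional]

theorem IsExceptional.not_prism_role [Finite V] (h : IsExceptional G) :
    ¬ HasRoleAssignment (prism G) 3 := by
  rcases isExceptional_iff.1 h with h | h | ⟨t, m, hm, hc, ⟨e⟩⟩
  · exact not_prism_role_of_completeFamily h
  · exact not_prism_role_of_isolatedFamily h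
  · exact fun h' => not_prism_role_of_starForest hm hc
      (hasRoleAssignment_iso (prismCongr _ e.symm) h')

theorem prism_role_of_not_connected [Finite V] [Nonempty V] (hG : ¬ G.Connected)
    (hex : ¬ IsExceptional G) : HasRoleAssignment (prism G) 3 := by
  rw [isExceptional_iff] at hex
  by_cases hiso : ∃ v, ∀ w, ¬ G.Adj v w
  · obtain ⟨v, hv⟩ := hiso
    by_cases hW : WalkThreeClosed G
    · have : ∃ m : ℕ, 1 ≤ m ∧ Nonempty (G ≃g (K 1 ⊕g KB 1 m)) := by
        by_contra hm
        exact hex (Or.inr (Or.inl ⟨⟨v, hv⟩, hW.components, hm⟩))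
      obtain ⟨m, hm, ⟨e⟩⟩ := this
      exact prism_role_of_iso_isolated_star hm e
    · unfold WalkThreeClosed at hW
      push Not at hW
      obtain ⟨a, b, c, d, hab, hbc, hcd, had⟩ := hW
      exact prism_role_of_isolated hv hab hbc hcd had
  push Not at hiso
  by_cases hstar : ∀ a b c d, G.Adj a b → G.Adj b c → G.Adj c d → a = c ∨ b = d
  · obtain ⟨t, m, hm, ⟨e⟩⟩ := nonempty_iso_starForest hiso hstar
    have hc : ¬ StarCondition m := fun hc => hex (Or.inr (Or.inr ⟨t, m, hm, hc, ⟨e⟩⟩))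
    refine hasRoleAssignment_iso (prismCongr G e) ?_
    have ht : 2 ≤ t := by
      by_contra ht
      have : Subsingleton (Fin t) := Fin.subsingleton_iff_le_one.2 (by omega)
      refine hG ⟨fun x y => ?_⟩
      have key : ∀ z, G.Reachable (e.symm ⟨(e x).1, Sum.inl 0⟩) z := by
        intro z
        obtain ⟨w, rfl⟩ := e.symm.surjective z
        rcases w with ⟨i, a⟩
        rw [Subsingleton.elim (e x).1 i]
        rcases a with a | a
        · rw [Subsingleton.elim a 0]
        · apply SimpleGraph.Adj.reachable
          rw [e.symm.map_adj_iff, starForest_adj]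
          simp
      exact (key x).symm.trans (key y)
    have ht' : t = 2 ∨ t = 3 := by
      have : ¬ 4 ≤ t := fun h => hc (Or.inl h)
      omega
    rcases ht' with rfl | rfl
    · have : ∃ i, ¬ 2 ≤ m i := by
        by_contra! h
        exact hc (Or.inr (Or.inr ⟨rfl, h⟩))
      obtain ⟨i, hi⟩ := this
      exact prism_role_of_starForest_two hm (i := i) (by have := hm i; omega)
    · have : m = fun _ => 1 := by
        funext i
        have := hm i
        by_contra hne
        exact hc (Or.inr (Or.inl ⟨le_rfl, i, by omega⟩))
      rw [this]
      exact prism_role_of_starForest_three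
  · push Not at hstar
    obtain ⟨x, y, z, w, hxy, hyz, hzw, hxz, hyw⟩ := hstar
    have : ∃ v, ¬ G.Reachable y v := by
      by_contra! hcon
      exact hG ⟨fun a b => (hcon a).symm.trans (hcon b)⟩
    obtain ⟨v, hv⟩ := this
    exact prism_role_of_not_star hiso hxy hyz hzw hxz hyw hv

/-- For complete `G` the edgeless complement qualifies; in the other families `G` itself does. -/
theorem IsExceptional.not_connected_isBipartite [Finite V] [Nontrivial V] (h : IsExceptional G) :
    (¬ G.Connected ∧ G.IsBipartite) ∨ (¬ Gᶜ.Connected ∧ Gᶜ.IsBipartite) := by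
  rcases isExceptional_iff.1 h with ⟨n, hn, ⟨e⟩⟩ | ⟨⟨v, hv⟩, h, -⟩ | ⟨t, m, hm, hc, ⟨e⟩⟩
  · right
    have hadj : ∀ x y, ¬ Gᶜ.Adj x y := by
      intro x y hxy
      rw [SimpleGraph.compl_adj, ← e.map_adj_iff] at hxy
      exact hxy.2 (by simpa using hxy.1)
    refine ⟨fun hcon => ?_, WalkThreeClosed.isBipartite fun a b c d hab => absurd hab (hadj a b)⟩
    obtain ⟨x⟩ := hcon.nonempty
    obtain ⟨y, hy⟩ := exists_adj_of_connected hcon x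
    exact hadj _ _ hy
  · left
    refine ⟨fun hcon => ?_, (walkThreeClosed_of_components h).isBipartite⟩
    obtain ⟨y, hy⟩ := exists_adj_of_connected hcon v
    exact hv _ hy
  · left
    refine ⟨not_connected_of_iso_starForest hc.two_le e, ?_⟩
    obtain ⟨C⟩ := starForest_isBipartite m
    exact ⟨C.comp e.toHom⟩

theorem isExceptional_of_subsingleton [Finite V] [Nonempty V] [Subsingleton V] :
    IsExceptional G := by
  have hadj : ∀ x y, ¬ G.Adj x y := fun x y hxy => hxy.ne (Subsingleton.elim x y)
  obtain ⟨v⟩ := ‹Nonempty V›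
  refine Or.inr (Or.inl ⟨⟨v, hadj v⟩, ?_, ?_⟩)
  · rintro C ⟨x, -, y, -, hxy⟩
    exact absurd (Subsingleton.elim x y) hxy
  · rintro ⟨m, hm, ⟨e⟩⟩
    have := e.symm.injective.ne
      (show (Sum.inl 0 : Fin 1 ⊕ (Fin 1 ⊕ Fin m)) ≠ Sum.inr (Sum.inl 0) by simp)
    exact this (Subsingleton.elim _ _)

end StarForest

end ComplementaryPrism

theorem mainTheorem1 {V : Type*} [Finite V] [Nonempty V] (G : SimpleGraph V) :
    (ComplementaryPrism.HasRoleAssignment (ComplementaryPrism.prism G) 3 ↔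
      ¬ ComplementaryPrism.IsExceptional G ∧ ¬ ComplementaryPrism.IsExceptional Gᶜ) ∧
    (Nontrivial V → ¬ ComplementaryPrism.HasRoleAssignment (ComplementaryPrism.prism G) 3 →
      (¬ G.Connected ∧ G.IsBipartite) ∨ (¬ Gᶜ.Connected ∧ Gᶜ.IsBipartite)) := by
  have hiff : ComplementaryPrism.HasRoleAssignment (ComplementaryPrism.prism G) 3 ↔
      ¬ ComplementaryPrism.IsExceptional G ∧ ¬ ComplementaryPrism.IsExceptional Gᶜ := by
    constructor
    · intro h
      refine ⟨fun h' => h'.not_prism_role h, fun h' => h'.not_prism_role ?_⟩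
      exact ComplementaryPrism.prism_compl_role Gᶜ (by rwa [compl_compl])
    · rintro ⟨h1, h2⟩
      rcases subsingleton_or_nontrivial V with hV | hV
      · exact absurd ComplementaryPrism.isExceptional_of_subsingleton h1
      by_cases hG : G.Connected
      · by_cases hGc : Gᶜ.Connected
        · exact ComplementaryPrism.prism_role_of_connected_of_compl_connected hG hGc
        · exact ComplementaryPrism.prism_compl_role G
            (ComplementaryPrism.prism_role_of_not_connected hGc h2)
      · exact ComplementaryPrism.prism_role_of_not_connected hG h1
  refine ⟨hiff, fun _ h => ?_⟩
  rw [hiff, not_and_or, not_not, not_not] at h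
  rcases h with h | h
  · exact h.not_connected_isBipartite
  · have := h.not_connected_isBipartite
    rw [compl_compl] at this
    exact this.symm
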